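/- Let $V:\mathbb R\to\mathbb R$ be a $C^3$ function with bounded second and third derivatives and let $l\in\mathbb R$ be a constant. On a probability space, let $(G^i_k)_{i,k\ge1}$ be i.i.d. standard normal random variables, independent of a sequence $(U_k)_{k\ge1}$ of i.i.d. random variables uniform on $[0,1]$. For each $n\ge1$ let $(X^{1,n}_0,\dots,X^{n,n}_0)$ be a random vector that is exchangeable (its law is invariant under permutations of the coordinates) and independent of $\big((G^i_k)_{i,k\ge1},(U_k)_{k\ge1}\big)$, and define the random walk Metropolis chain, for $k\ge0$ and $1\le i\le n$, by $$X^{i,n}_{k+1}=X^{i,n}_k+\frac{l}{\sqrt n}\,G^i_{k+1}\,1_{\mathcal A_{k+1}},\qquad \mathcal A_{k+1}=\Big\{U_{k+1}\le e^{\sum_{j=1}^n\left(V(X^{j,n}_k)-V\left(X^{j,n}_k+\frac{l}{\sqrt n}G^j_{k+1}\right)\right)}\Big\}.$$ For $t\ge0$ let $$Y^{1,n}_t=X^{1,n}_{\lfloor nt\rfloor}+(nt-\lfloor nt\rfloor)\big(X^{1,n}_{\lceil nt\rceil}-X^{1,n}_{\lfloor nt\rfloor}\big)$$ be the linear interpolation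 of the rescaled first coordinate, so that $Y^{1,n}_{k/n}=X^{1,n}_k$ for all integers $k\ge0$. Let $C(\mathbb R_+,\mathbb R)$ be the space of continuous functions from $\mathbb R_+$ to $\mathbb R$, with the topology of uniform convergence on compact sets and its Borel $\sigma$-field. Suppose that the laws of the random variables $X^{1,n}_0$, $n\ge1$, are tight and that $\sup_{n\ge1}\mathbb E[(V'(X^{1,n}_0))^4]<\infty$. Then each $Y^{1,n}$ is a random variable with values in $C(\mathbb R_+,\mathbb R)$, the laws of the processes $Y^{1,n}$, $n\ge1$, are tight in $C(\mathbb R_+,\mathbb R)$, and the function $t\mapsto\sup_{n\ge1}\mathbb E[(V'(Y^{1,n}_t))^4]$ is locally bounded on $\mathbb R_+$ (every $t_0\ge0$ has a neighbourhood in $\mathbb R_+$ on which it is bounded by a finite constant). -/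

import Mathlib

open MeasureTheory ProbabilityTheory Filter Topology
open scoped NNReal ENNReal

namespace RWM

/-- The path space of continuous functions from `ℝ≥0` to `ℝ`, whose topology in Mathlib is that of
uniform convergence on compact sets, carries its Borel sigma-field. -/
instance instMeasurableSpacePath : MeasurableSpace C(ℝ≥0, ℝ) := borel _

instance instBorelSpacePath : BorelSpace C(ℝ≥0, ℝ) := ⟨rfl⟩

/-- The event that a proposed move is accepted: from the position `x`, with Gaussian vector `g`
and uniform variable `u`, the proposal being `x + (l / √n) g`. -/
def Accepted (V : ℝ → ℝ) (l : ℝ) {n : ℕ} (x g : Fin n → ℝ) (u : ℝ) : Prop :=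
  u ≤ Real.exp (∑ i, (V (x i) - V (x i + l / √(n : ℝ) * g i)))

open Classical in
/-- One step of the random walk Metropolis algorithm for the target with density proportional
to `exp (-∑ i, V (x i))` and Gaussian proposals of variance `l ^ 2 / n`. -/
noncomputable def step (V : ℝ → ℝ) (l : ℝ) {n : ℕ} (x g : Fin n → ℝ) (u : ℝ) : Fin n → ℝ :=
  fun i => x i + l / √(n : ℝ) * g i * (if Accepted V l x g u then 1 else 0)

/-- The random walk Metropolis chain in dimension `n` started from `X₀`. The variables `G i k` and
`U k` are those used in the transition from time `k` to time `k + 1`; coordinates are numbered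
from `0`. -/
noncomputable def chain {Ω : Type*} (V : ℝ → ℝ) (l : ℝ) {n : ℕ} (X₀ : Ω → Fin n → ℝ)
    (G : ℕ → ℕ → Ω → ℝ) (U : ℕ → Ω → ℝ) : ℕ → Ω → Fin n → ℝ
  | 0 => X₀
  | k + 1 => fun ω => step V l (chain V l X₀ G U k ω) (fun i => G i k ω) (U k ω)

/-- The value at time `t` of the linear interpolation of the sequence `x`, the `k`-th term being
placed at time `k / n`. -/
noncomputable def interp (n : ℕ+) (x : ℕ → ℝ) (t : ℝ≥0) : ℝ :=
  x ⌊(n : ℝ) * t⌋₊ + ((n : ℝ) * t - ⌊(n : ℝ) * t⌋₊) * (x ⌈(n : ℝ) * t⌉₊ - x ⌊(n : ℝ) * t⌋₊)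

/-- On each interval between consecutive grid times the interpolation is affine. -/
theorem interp_eq (n : ℕ+) (x : ℕ → ℝ) (k : ℕ) (t : ℝ≥0) (h₁ : (k : ℝ) ≤ (n : ℝ) * t)
    (h₂ : (n : ℝ) * t ≤ k + 1) :
    interp n x t = x k + ((n : ℝ) * t - k) * (x (k + 1) - x k) := by
  unfold interp
  rcases h₁.eq_or_lt with h | h
  · rw [← h]; simp
  rcases h₂.eq_or_lt with h' | h'
  · have e : (n : ℝ) * t = ((k + 1 : ℕ) : ℝ) := by rw [h']; push_cast; ring
    rw [e, Nat.floor_natCast, Nat.ceil_natCast]; push_cast; ring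
  · have e₁ : ⌊(n : ℝ) * t⌋₊ = k := (Nat.floor_eq_iff (by positivity)).2 ⟨h₁, h'⟩
    have e₂ : ⌈(n : ℝ) * t⌉₊ = k + 1 := by
      rw [Nat.ceil_eq_iff (by omega)]
      exact ⟨by simpa using h, by simpa using h₂⟩
    rw [e₁, e₂]

theorem continuous_interp (n : ℕ+) (x : ℕ → ℝ) : Continuous (interp n x) := by
  have hn : (0 : ℝ) < n := by exact_mod_cast n.pos
  let S : ℕ → Set ℝ≥0 := fun k => {t | (k : ℝ) ≤ (n : ℝ) * t ∧ (n : ℝ) * t ≤ k + 1}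
  have hS : LocallyFinite S := by
    intro t
    refine ⟨{s | (n : ℝ) * s < (n : ℝ) * t + 1}, ?_, ?_⟩
    · exact (isOpen_lt (f := fun s : ℝ≥0 => (n : ℝ) * s) (by fun_prop)
        continuous_const).mem_nhds (by simp)
    · refine (Set.finite_le_nat ⌈(n : ℝ) * t + 1⌉₊).subset ?_
      rintro k ⟨s, hs₁, hs₂⟩
      have h : (k : ℝ) ≤ (n : ℝ) * t + 1 := le_trans hs₁.1 (le_of_lt hs₂)
      exact_mod_cast h.trans (Nat.le_ceil _)
  refine hS.continuous ?_ (fun k => ?_) (fun k => ?_)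
  · refine Set.eq_univ_of_forall (fun t => Set.mem_iUnion.2 ⟨⌊(n : ℝ) * t⌋₊, ?_, ?_⟩)
    · exact Nat.floor_le (by positivity)
    · exact (Nat.lt_floor_add_one _).le
  · exact (isClosed_le continuous_const (g := fun s : ℝ≥0 => (n : ℝ) * s) (by fun_prop)).inter
      (isClosed_le (f := fun s : ℝ≥0 => (n : ℝ) * s) (by fun_prop) continuous_const)
  · refine ContinuousOn.congr (f := fun t : ℝ≥0 => x k + ((n : ℝ) * t - k) * (x (k + 1) - x k))
      (by fun_prop) (fun t ht => interp_eq n x k t ht.1 ht.2)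

/-- The linear interpolation of a sequence, as an element of the path space. -/
noncomputable def interpPath (n : ℕ+) (x : ℕ → ℝ) : C(ℝ≥0, ℝ) :=
  ⟨interp n x, continuous_interp n x⟩

/-- The index of the first coordinate. -/
def first (n : ℕ+) : Fin n := ⟨0, n.pos⟩

/-- The path of the linearly interpolated first coordinate of the chain in dimension `n`, with
time accelerated by the factor `n`. -/
noncomputable def Y {Ω : Type*} (V : ℝ → ℝ) (l : ℝ) (n : ℕ+) (X₀ : Ω → Fin n → ℝ)
    (G : ℕ → ℕ → Ω → ℝ) (U : ℕ → Ω → ℝ) (ω : Ω) : C(ℝ≥0, ℝ) :=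
  interpPath n (fun k => chain V l X₀ G U k ω (first n))

/-- The law of the random vector `X` is invariant under permutations of the coordinates. -/
def Exchangeable {Ω : Type*} [MeasurableSpace Ω] (P : Measure Ω) {n : ℕ}
    (X : Ω → Fin n → ℝ) : Prop :=
  ∀ σ : Equiv.Perm (Fin n), P.map (fun ω i => X ω (σ i)) = P.map X

end RWM

namespace RWM

section Independence

variable {Ω α β γ : Type*} [MeasurableSpace Ω] [MeasurableSpace α] [MeasurableSpace β]
  [MeasurableSpace γ] {P : Measure Ω} [IsProbabilityMeasure P]

theorem indepFun_prodMk_right {X : Ω → α} {Y : Ω → β} {Z : Ω → γ} (hX : Measurable X)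
    (hY : Measurable Y) (hZ : Measurable Z) (h₁ : IndepFun X Y P)
    (h₂ : IndepFun (fun ω => (X ω, Y ω)) Z P) :
    IndepFun X (fun ω => (Y ω, Z ω)) P := by
  have h₃ : IndepFun Y Z P := h₂.comp measurable_snd measurable_id
  have e₁ := (indepFun_iff_map_prod_eq_prod_map_map hX.aemeasurable hY.aemeasurable).1 h₁
  have e₂ := (indepFun_iff_map_prod_eq_prod_map_map (hX.prodMk hY).aemeasurable
    hZ.aemeasurable).1 h₂
  have e₃ := (indepFun_iff_map_prod_eq_prod_map_map hY.aemeasurable hZ.aemeasurable).1 h₃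
  rw [indepFun_iff_map_prod_eq_prod_map_map hX.aemeasurable (hY.prodMk hZ).aemeasurable, e₃]
  have := Measure.isProbabilityMeasure_map (μ := P) hX.aemeasurable
  have := Measure.isProbabilityMeasure_map (μ := P) hY.aemeasurable
  have := Measure.isProbabilityMeasure_map (μ := P) hZ.aemeasurable
  rw [← Measure.prodAssoc_prod, ← e₁, ← e₂,
    Measure.map_map MeasurableEquiv.prodAssoc.measurable ((hX.prodMk hY).prodMk hZ)]
  rfl

end Independence

theorem exp_min_zero_sub_exp_le {p q : ℝ} (h : q ≤ p) :
    min 1 (Real.exp p) - Real.exp q ≤ p - q := by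
  have key : ∀ a : ℝ, q ≤ a → a ≤ 0 → Real.exp a - Real.exp q ≤ a - q := fun a h₁ h₂ => by
    have e₁ : Real.exp q = Real.exp a * Real.exp (q - a) := by rw [← Real.exp_add]; ring_nf
    have e₂ := Real.add_one_le_exp (q - a)
    have e₃ : Real.exp a ≤ 1 := Real.exp_le_one_iff.2 h₂
    rw [e₁]
    nlinarith [Real.exp_pos a]
  rcases le_total p 0 with hp | hp
  · exact (sub_le_sub_right (min_le_right _ _) _).trans (key p h hp)
  · have h1 : min 1 (Real.exp p) ≤ 1 := min_le_left _ _
    rcases le_total q 0 with hq | hq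
    · have := key 0 hq le_rfl
      rw [Real.exp_zero] at this
      linarith
    · have := Real.one_le_exp hq
      linarith

/-- The acceptance probability `min 1 (exp p)` is a 1-Lipschitz function of `p`, for the coupling
of acceptance events given by a common uniform variable. -/
theorem lintegral_abs_ite_sub_ite_le (p q : ℝ) :
    ∫⁻ u, ENNReal.ofReal |(if u ≤ Real.exp p then (1 : ℝ) else 0) -
      (if u ≤ Real.exp q then 1 else 0)| ∂(volume.restrict (Set.Icc (0 : ℝ) 1)) ≤
      ENNReal.ofReal |p - q| := by
  wlog h : q ≤ p generalizing p q
  · simpa only [abs_sub_comm] using this q p (le_of_not_ge h)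
  have e : ∀ u : ℝ, ENNReal.ofReal |(if u ≤ Real.exp p then (1 : ℝ) else 0) -
      (if u ≤ Real.exp q then 1 else 0)| = (Set.Ioc (Real.exp q) (Real.exp p)).indicator 1 u := by
    intro u
    have := Real.exp_le_exp.2 h
    by_cases h₁ : u ≤ Real.exp p <;> by_cases h₂ : u ≤ Real.exp q
    · simp [h₁, h₂]
    · simp [h₁, h₂, not_le.1 h₂]
    · exact absurd (h₂.trans this) h₁
    · simp [h₁, h₂]
  simp_rw [e]
  rw [lintegral_indicator_one measurableSet_Ioc, Measure.restrict_apply measurableSet_Ioc,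
    abs_of_nonneg (sub_nonneg.2 h)]
  calc volume (Set.Ioc (Real.exp q) (Real.exp p) ∩ Set.Icc 0 1)
      ≤ volume (Set.Icc (Real.exp q) (min 1 (Real.exp p))) :=
        measure_mono fun u hu => ⟨hu.1.1.le, le_min hu.2.2 hu.1.2⟩
    _ ≤ ENNReal.ofReal (p - q) := by
        rw [Real.volume_Icc]
        exact ENNReal.ofReal_le_ofReal (exp_min_zero_sub_exp_le h)

theorem lintegral_mul_abs_ite_sub_ite_le {Ω β : Type*} [MeasurableSpace Ω] [MeasurableSpace β]
    {P : Measure Ω} [IsProbabilityMeasure P] {R : Ω → β} {u : Ω → ℝ} (hR : Measurable R)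
    (hu : Measurable u) (hind : IndepFun R u P)
    (hulaw : P.map u = volume.restrict (Set.Icc (0 : ℝ) 1)) {w : β → ℝ≥0∞} {p q : β → ℝ}
    (hw : Measurable w) (hp : Measurable p) (hq : Measurable q) :
    ∫⁻ ω, w (R ω) * ENNReal.ofReal |(if u ω ≤ Real.exp (p (R ω)) then (1 : ℝ) else 0) -
      (if u ω ≤ Real.exp (q (R ω)) then 1 else 0)| ∂P ≤
      ∫⁻ ω, w (R ω) * ENNReal.ofReal |p (R ω) - q (R ω)| ∂P := by
  have hI : ∀ p : β → ℝ, Measurable p →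
      Measurable fun z : β × ℝ => if z.2 ≤ Real.exp (p z.1) then (1 : ℝ) else 0 := fun p hp =>
    Measurable.ite (measurableSet_le measurable_snd (by fun_prop)) measurable_const
      measurable_const
  have hΦ : Measurable fun z : β × ℝ => ENNReal.ofReal
      |(if z.2 ≤ Real.exp (p z.1) then (1 : ℝ) else 0) -
        (if z.2 ≤ Real.exp (q z.1) then 1 else 0)| := by
    have h₁ := hI p hp
    have h₂ := hI q hq
    fun_prop
  have e := (indepFun_iff_map_prod_eq_prod_map_map hR.aemeasurable hu.aemeasurable).1 hind
  have := Measure.isProbabilityMeasure_map (μ := P) hu.aemeasurable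
  have hwΦ : Measurable fun z : β × ℝ => w z.1 * ENNReal.ofReal
      |(if z.2 ≤ Real.exp (p z.1) then (1 : ℝ) else 0) -
        (if z.2 ≤ Real.exp (q z.1) then 1 else 0)| := (hw.comp measurable_fst).mul hΦ
  rw [← lintegral_map (μ := P) hwΦ (hR.prodMk hu), e, lintegral_prod _ hwΦ.aemeasurable,
    lintegral_map (hwΦ.lintegral_prod_right' (ν := P.map u)) hR]
  refine lintegral_mono fun ω => ?_
  dsimp only
  have := hΦ.comp (measurable_prodMk_left (x := R ω))
  simp only [Function.comp_def] at this
  rw [lintegral_const_mul _ this, hulaw]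
  gcongr
  exact lintegral_abs_ite_sub_ite_le _ _

/-- A constant dominating all absolute moments of order at most 4 of a standard normal variable. -/
noncomputable def gaussM : ℝ := ∫ z, (1 + z ^ 4) ∂(gaussianReal 0 1)

theorem gaussM_nonneg : 0 ≤ gaussM := integral_nonneg fun z => by positivity

theorem sq_le_one_add_pow_four (z : ℝ) : z ^ 2 ≤ 1 + z ^ 4 := by nlinarith [sq_nonneg (z ^ 2 - 1)]

theorem abs_pow_three_le_one_add_pow_four (z : ℝ) : |z| ^ 3 ≤ 1 + z ^ 4 := by
  have h : z ^ 4 = |z| ^ 4 := by rw [← abs_pow, abs_of_nonneg (by positivity)]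
  rw [h]
  nlinarith [sq_nonneg (|z| ^ 2 - |z|), sq_nonneg (|z| - 1), sq_nonneg (|z| ^ 2 - 1),
    abs_nonneg z]

section OneStep

variable {Ω β : Type*} [MeasurableSpace Ω] [MeasurableSpace β] {P : Measure Ω} {g u : Ω → ℝ}

theorem integrable_gaussian_pow_four (hg : Measurable g) (hglaw : P.map g = gaussianReal 0 1) :
    Integrable (fun ω => 1 + g ω ^ 4) P := by
  have h : Integrable (fun z : ℝ => 1 + z ^ 4) (P.map g) := by
    rw [hglaw]
    have := (memLp_id_gaussianReal (μ := 0) (v := 1) 4).integrable_norm_pow (p := 4) (by simp)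
    refine (integrable_const 1).add (this.congr (ae_of_all _ fun z => ?_))
    simp only [id, Real.norm_eq_abs]
    rw [← abs_pow, abs_of_nonneg (by positivity)]
  exact h.comp_measurable hg

theorem integral_gaussian_pow_four (hg : Measurable g) (hglaw : P.map g = gaussianReal 0 1) :
    ∫ ω, (1 + g ω ^ 4) ∂P = gaussM := by
  rw [gaussM, ← hglaw, integral_map hg.aemeasurable (by fun_prop)]

theorem integrable_gaussian (hg : Measurable g) (hglaw : P.map g = gaussianReal 0 1) :
    Integrable g P := by
  have h : Integrable (fun z : ℝ => z) (P.map g) := by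
    rw [hglaw]
    exact (memLp_id_gaussianReal (μ := 0) (v := 1) 1).integrable (by simp)
  exact h.comp_measurable hg

theorem integral_gaussian (hg : Measurable g) (hglaw : P.map g = gaussianReal 0 1) :
    ∫ ω, g ω ∂P = 0 := by
  have h := integral_map (μ := P) (f := fun z : ℝ => z) hg.aemeasurable (by fun_prop)
  rw [← h, hglaw, integral_id_gaussianReal]

variable [IsProbabilityMeasure P] {W : Ω → β} {V φ : ℝ → ℝ} {B : ℝ} {x s : β → ℝ}

theorem abs_ite_le_one (p : Prop) [Decidable p] : |if p then (1 : ℝ) else 0| ≤ 1 := by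
  split_ifs <;> simp

/-- The drift of one Metropolis step is of the order of the variance of the proposal. -/
theorem abs_integral_mul_increment_le (hW : Measurable W) (hg : Measurable g) (hu : Measurable u)
    (hWg : IndepFun W g P) (hWgu : IndepFun (fun ω => (W ω, g ω)) u P)
    (hglaw : P.map g = gaussianReal 0 1)
    (hulaw : P.map u = volume.restrict (Set.Icc (0 : ℝ) 1))
    (hV : Measurable V) (hφ : Measurable φ) (hB : 0 ≤ B)
    (hVφ : ∀ y h, |V (y + h) - V y| ≤ |φ y| * |h| + B * h ^ 2)
    (hx : Measurable x) (hs : Measurable s) (δ : ℝ) {H : β → ℝ} (hHm : Measurable H)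
    (hH : Integrable (fun ω => H (W ω)) P)
    (hHφ : Integrable (fun ω => H (W ω) * φ (x (W ω))) P) :
    |∫ ω, H (W ω) * (δ * g ω * (if u ω ≤ Real.exp (s (W ω) + (V (x (W ω)) -
      V (x (W ω) + δ * g ω))) then 1 else 0)) ∂P| ≤
      δ ^ 2 * gaussM * ∫ ω, |H (W ω)| * (|φ (x (W ω))| + B * |δ|) ∂P := by
  set J₁ : Ω → ℝ := fun ω => if u ω ≤ Real.exp (s (W ω) + (V (x (W ω)) -
      V (x (W ω) + δ * g ω))) then 1 else 0 with hJ₁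
  set J₀ : Ω → ℝ := fun ω => if u ω ≤ Real.exp (s (W ω)) then 1 else 0 with hJ₀
  have mJ₁ : Measurable J₁ := Measurable.ite (measurableSet_le hu (by fun_prop)) measurable_const
      measurable_const
  have mJ₀ : Measurable J₀ := Measurable.ite (measurableSet_le hu (by fun_prop)) measurable_const
      measurable_const
  have hHg : Integrable (fun ω => H (W ω) * g ω) P :=
    IndepFun.integrable_mul (hWg.comp hHm measurable_id) hH (integrable_gaussian hg hglaw)
  have hint : ∀ J : Ω → ℝ, Measurable J → (∀ ω, |J ω| ≤ 1) →
      Integrable (fun ω => H (W ω) * (δ * g ω * J ω)) P := by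
    intro J mJ hJ
    refine ((hHg.const_mul δ).norm).mono' (by fun_prop) (ae_of_all _ fun ω => ?_)
    simp only [Real.norm_eq_abs, abs_mul]
    have := mul_le_mul_of_nonneg_left (hJ ω)
      (by positivity : 0 ≤ |δ| * (|H (W ω)| * |g ω|))
    linarith
  have i₁ := hint J₁ mJ₁ fun ω => abs_ite_le_one _
  have i₀ := hint J₀ mJ₀ fun ω => abs_ite_le_one _
  have z₀ : ∫ ω, H (W ω) * (δ * g ω * J₀ ω) ∂P = 0 := by
    have hgW : IndepFun g (fun ω => (W ω, u ω)) P :=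
      indepFun_prodMk_right hg hW hu hWg.symm
        (hWgu.comp (φ := Prod.swap) measurable_swap measurable_id)
    have hm : Measurable fun z : β × ℝ => H z.1 * δ * if z.2 ≤ Real.exp (s z.1) then 1 else 0 :=
      ((hHm.comp measurable_fst).mul_const δ).mul
        (Measurable.ite (measurableSet_le measurable_snd (by fun_prop)) measurable_const
          measurable_const)
    have := IndepFun.integral_mul_eq_mul_integral (hgW.comp measurable_id hm)
      hg.aestronglyMeasurable (hm.comp (hW.prodMk hu)).aestronglyMeasurable
    rw [show ∫ ω, (id ∘ g) ω ∂P = 0 from integral_gaussian hg hglaw, zero_mul] at this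
    rw [← this]
    refine integral_congr_ae (ae_of_all _ fun ω => ?_)
    simp only [hJ₀, Pi.mul_apply, Function.comp_apply, id]
    ring
  have e : ∫ ω, H (W ω) * (δ * g ω * J₁ ω) ∂P =
      ∫ ω, H (W ω) * (δ * g ω * (J₁ ω - J₀ ω)) ∂P := by
    rw [← sub_zero (∫ ω, H (W ω) * (δ * g ω * J₁ ω) ∂P), ← z₀, ← integral_sub i₁ i₀]
    refine integral_congr_ae (ae_of_all _ fun ω => ?_)
    dsimp only
    ring
  rw [e]
  have hind : IndepFun (fun ω => |H (W ω)| * (|φ (x (W ω))| + B * |δ|))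
      (fun ω => 1 + g ω ^ 4) P :=
    hWg.comp (φ := fun w => |H w| * (|φ (x w)| + B * |δ|)) (ψ := fun z : ℝ => 1 + z ^ 4)
      (by fun_prop) (by fun_prop)
  have hA : Integrable (fun ω => |H (W ω)| * (|φ (x (W ω))| + B * |δ|)) P := by
    refine (hHφ.abs.add (hH.abs.mul_const (B * |δ|))).congr (ae_of_all _ fun ω => ?_)
    simp only [Pi.add_apply, abs_mul]
    ring
  have hprod : Integrable (fun ω => |H (W ω)| * (|φ (x (W ω))| + B * |δ|) * (1 + g ω ^ 4)) P :=
    IndepFun.integrable_mul hind hA (integrable_gaussian_pow_four hg hglaw)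
  have eprod := IndepFun.integral_fun_mul_eq_mul_integral hind hA.aestronglyMeasurable
    (integrable_gaussian_pow_four hg hglaw).aestronglyMeasurable
  rw [integral_gaussian_pow_four hg hglaw] at eprod
  have hR : Measurable fun ω => (W ω, g ω) := hW.prodMk hg
  have key := lintegral_mul_abs_ite_sub_ite_le hR hu hWgu hulaw
    (w := fun z => ENNReal.ofReal |H z.1 * (δ * z.2)|)
    (p := fun z => s z.1 + (V (x z.1) - V (x z.1 + δ * z.2))) (q := fun z => s z.1)
    (by fun_prop) (by fun_prop) (by fun_prop)
  have hI : 0 ≤ ∫ ω, |H (W ω)| * (|φ (x (W ω))| + B * |δ|) ∂P :=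
    integral_nonneg fun ω => by positivity
  rw [← Real.norm_eq_abs]
  refine (norm_integral_le_lintegral_norm _).trans (ENNReal.toReal_le_of_le_ofReal
    (mul_nonneg (mul_nonneg (sq_nonneg _) gaussM_nonneg) hI) ?_)
  calc ∫⁻ ω, ENNReal.ofReal ‖H (W ω) * (δ * g ω * (J₁ ω - J₀ ω))‖ ∂P
      = ∫⁻ ω, ENNReal.ofReal |H (W ω) * (δ * g ω)| * ENNReal.ofReal |J₁ ω - J₀ ω| ∂P := by
        refine lintegral_congr fun ω => ?_
        rw [← ENNReal.ofReal_mul (abs_nonneg _), ← abs_mul, mul_assoc (H (W ω)),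
          Real.norm_eq_abs]
    _ ≤ _ := key
    _ ≤ ∫⁻ ω, ENNReal.ofReal (δ ^ 2 * (|H (W ω)| * (|φ (x (W ω))| + B * |δ|) *
          (1 + g ω ^ 4))) ∂P := by
        refine lintegral_mono fun ω => ?_
        dsimp only
        rw [← ENNReal.ofReal_mul (abs_nonneg _)]
        refine ENNReal.ofReal_le_ofReal ?_
        have h₁ := hVφ (x (W ω)) (δ * g ω)
        rw [show s (W ω) + (V (x (W ω)) - V (x (W ω) + δ * g ω)) - s (W ω) =
          -(V (x (W ω) + δ * g ω) - V (x (W ω))) by ring, abs_neg]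
        have h₂ := sq_le_one_add_pow_four (g ω)
        have h₃ := abs_pow_three_le_one_add_pow_four (g ω)
        calc |H (W ω) * (δ * g ω)| * |V (x (W ω) + δ * g ω) - V (x (W ω))|
            ≤ |H (W ω) * (δ * g ω)| * (|φ (x (W ω))| * |δ * g ω| + B * (δ * g ω) ^ 2) := by
              gcongr
          _ = |H (W ω)| * (|φ (x (W ω))| * (δ ^ 2 * g ω ^ 2) +
                B * |δ| * (δ ^ 2 * |g ω| ^ 3)) := by
              rw [← sq_abs (δ * g ω), ← sq_abs δ, ← sq_abs (g ω)]
              simp only [abs_mul]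
              ring
          _ ≤ |H (W ω)| * (|φ (x (W ω))| * (δ ^ 2 * (1 + g ω ^ 4)) +
                B * |δ| * (δ ^ 2 * (1 + g ω ^ 4))) := by gcongr
          _ = _ := by ring
    _ = ENNReal.ofReal (δ ^ 2 * gaussM * ∫ ω, |H (W ω)| * (|φ (x (W ω))| + B * |δ|) ∂P) := by
        rw [← ofReal_integral_eq_lintegral_ofReal (hprod.const_mul (δ ^ 2))
          (ae_of_all _ fun ω => by simp only [Pi.zero_apply]; positivity),
          integral_const_mul, eprod]
        congr 1
        ring

theorem add_pow_four_le {F r c h b γ : ℝ} (hr : |r| ≤ b * |h|)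
    (hrc : |r - c * h| ≤ γ * h ^ 2) :
    (F + r) ^ 4 ≤ F ^ 4 + 4 * (F ^ 3 * c * h) + (4 * γ * |F| ^ 3 + 8 * b ^ 2 * F ^ 2) * h ^ 2 +
      3 * b ^ 4 * h ^ 4 := by
  have h₁ : F ^ 3 * (r - c * h) ≤ |F| ^ 3 * (γ * h ^ 2) := by
    refine (le_abs_self _).trans ?_
    rw [abs_mul, abs_pow]
    gcongr
  have h₂ : r ^ 2 ≤ b ^ 2 * h ^ 2 := by
    rw [← sq_abs r, ← sq_abs h, ← mul_pow]
    gcongr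
  have h₃ : r ^ 4 ≤ b ^ 4 * h ^ 4 := by
    calc r ^ 4 = (r ^ 2) ^ 2 := by ring
      _ ≤ (b ^ 2 * h ^ 2) ^ 2 := by gcongr
      _ = _ := by ring
  have h₄ : F ^ 2 * r ^ 2 ≤ F ^ 2 * (b ^ 2 * h ^ 2) := by gcongr
  have h₅ : 4 * (F * r ^ 3) ≤ 2 * (F ^ 2 * r ^ 2) + 2 * r ^ 4 := by
    nlinarith [mul_nonneg (sq_nonneg r) (sq_nonneg (F - r))]
  nlinarith

theorem integral_add_pow_four_le (hW : Measurable W) (hg : Measurable g) (hu : Measurable u)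
    (hWg : IndepFun W g P) (hWgu : IndepFun (fun ω => (W ω, g ω)) u P)
    (hglaw : P.map g = gaussianReal 0 1)
    (hulaw : P.map u = volume.restrict (Set.Icc (0 : ℝ) 1))
    (hV : Measurable V) (hφ : Measurable φ) (hB : 0 ≤ B)
    (hVφ : ∀ y h, |V (y + h) - V y| ≤ |φ y| * |h| + B * h ^ 2)
    (hx : Measurable x) (hs : Measurable s) {δ d : ℝ} (hδ : |δ| ≤ d) {F c : β → ℝ}
    (hFm : Measurable F) (hcm : Measurable c) {b γ : ℝ} (hγ : 0 ≤ γ) {r h : Ω → ℝ}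
    (hh : ∀ ω, h ω = δ * g ω * (if u ω ≤ Real.exp (s (W ω) + (V (x (W ω)) -
      V (x (W ω) + δ * g ω))) then 1 else 0))
    (hrm : Measurable r) (hc : ∀ w, |c w| ≤ b) (hr : ∀ ω, |r ω| ≤ b * |h ω|)
    (hrc : ∀ ω, |r ω - c (W ω) * h ω| ≤ γ * h ω ^ 2)
    (hF : Integrable (fun ω => F (W ω) ^ 4) P)
    (hφx : Integrable (fun ω => φ (x (W ω)) ^ 4) P) :
    Integrable (fun ω => (F (W ω) + r ω) ^ 4) P ∧
    ∫ ω, (F (W ω) + r ω) ^ 4 ∂P ≤ ∫ ω, F (W ω) ^ 4 ∂P +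
      δ ^ 2 * (gaussM * (4 * b * (1 + B * d) + 4 * γ + 8 * b ^ 2 + 3 * b ^ 4)) *
        ∫ ω, (|F (W ω)| ^ 3 * (|φ (x (W ω))| + 1) + F (W ω) ^ 2) ∂P +
      δ ^ 4 * (gaussM * (4 * b * (1 + B * d) + 4 * γ + 8 * b ^ 2 + 3 * b ^ 4)) := by
  have hd : 0 ≤ d := (abs_nonneg _).trans hδ
  have hm := gaussM_nonneg
  have hmm : Measurable h := by
    have : Measurable fun ω => if u ω ≤ Real.exp (s (W ω) + (V (x (W ω)) -
        V (x (W ω) + δ * g ω))) then (1 : ℝ) else 0 :=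
      Measurable.ite (measurableSet_le hu (by fun_prop)) measurable_const measurable_const
    rw [funext hh]
    fun_prop
  have hb : 0 ≤ b := by
    obtain ⟨w⟩ : Nonempty β := (nonempty_of_isProbabilityMeasure P).map W
    exact (abs_nonneg _).trans (hc w)
  have habs4 : ∀ z : ℝ, |z| ^ 4 = z ^ 4 := fun z => by
    rw [← abs_pow, abs_of_nonneg (by positivity)]
  have hdom : Integrable (fun ω => 1 + F (W ω) ^ 4 + φ (x (W ω)) ^ 4) P :=
    ((integrable_const 1).add hF).add hφx
  have hdom_le : ∀ a y : ℝ, 0 ≤ a → 0 ≤ y → a ^ 3 * y ≤ a ^ 4 + y ^ 4 := fun a y ha hy => by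
    rcases le_total a y with h | h
    · calc a ^ 3 * y ≤ y ^ 3 * y := by gcongr
        _ ≤ _ := by nlinarith [pow_nonneg ha 4]
    · calc a ^ 3 * y ≤ a ^ 3 * a := by gcongr
        _ ≤ _ := by nlinarith [pow_nonneg hy 4]
  have iF3 : Integrable (fun ω => |F (W ω)| ^ 3) P :=
    hdom.mono' (Measurable.aestronglyMeasurable (by fun_prop)) (ae_of_all _ fun ω => by
      rw [Real.norm_eq_abs, abs_of_nonneg (by positivity)]
      have := abs_pow_three_le_one_add_pow_four (F (W ω))
      have : 0 ≤ φ (x (W ω)) ^ 4 := by positivity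
      linarith)
  have iF2 : Integrable (fun ω => F (W ω) ^ 2) P :=
    hdom.mono' (Measurable.aestronglyMeasurable (by fun_prop)) (ae_of_all _ fun ω => by
      rw [Real.norm_eq_abs, abs_of_nonneg (by positivity)]
      have := sq_le_one_add_pow_four (F (W ω))
      have : 0 ≤ φ (x (W ω)) ^ 4 := by positivity
      linarith)
  have iF3φ : Integrable (fun ω => |F (W ω)| ^ 3 * |φ (x (W ω))|) P :=
    hdom.mono' (Measurable.aestronglyMeasurable (by fun_prop)) (ae_of_all _ fun ω => by
      rw [Real.norm_eq_abs, abs_of_nonneg (by positivity)]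
      have := hdom_le _ _ (abs_nonneg (F (W ω))) (abs_nonneg (φ (x (W ω))))
      rw [habs4, habs4] at this
      linarith)
  have iH : Integrable (fun ω => F (W ω) ^ 3 * c (W ω)) P :=
    (iF3.mul_const b).mono' (by fun_prop) (ae_of_all _ fun ω => by
      rw [Real.norm_eq_abs, abs_mul, abs_pow]
      have := hc (W ω)
      gcongr)
  have iHφ : Integrable (fun ω => F (W ω) ^ 3 * c (W ω) * φ (x (W ω))) P :=
    (iF3φ.mul_const b).mono' (by fun_prop) (ae_of_all _ fun ω => by
      rw [Real.norm_eq_abs, abs_mul, abs_mul, abs_pow]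
      have := mul_le_mul_of_nonneg_left (hc (W ω))
        (by positivity : 0 ≤ |F (W ω)| ^ 3 * |φ (x (W ω))|)
      linarith)
  have drift := abs_integral_mul_increment_le (H := fun w => F w ^ 3 * c w) hW hg hu hWg hWgu
    hglaw hulaw hV hφ hB hVφ hx hs δ (by fun_prop) iH iHφ
  have hg4 := integrable_gaussian_pow_four hg hglaw
  have hh2 : ∀ ω, h ω ^ 2 ≤ δ ^ 2 * (1 + g ω ^ 4) := fun ω => by
    have h₁ := sq_le_one_add_pow_four (g ω)
    have h₂ : δ ^ 2 * g ω ^ 2 ≤ δ ^ 2 * (1 + g ω ^ 4) := by gcongr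
    rw [hh]
    split_ifs
    · linarith
    · rw [mul_zero, zero_pow (by norm_num)]
      positivity
  have hh4 : ∀ ω, h ω ^ 4 ≤ δ ^ 4 * (1 + g ω ^ 4) := fun ω => by
    rw [hh]
    split_ifs
    · have : 0 ≤ δ ^ 4 := by positivity
      linarith
    · rw [mul_zero, zero_pow (by norm_num)]
      positivity
  have iHh : Integrable (fun ω => F (W ω) ^ 3 * c (W ω) * h ω) P := by
    have hHg : Integrable (fun ω => (F (W ω) ^ 3 * c (W ω)) * g ω) P :=
      IndepFun.integrable_mul (hWg.comp (φ := fun w => F w ^ 3 * c w) (by fun_prop)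
        measurable_id) iH (integrable_gaussian hg hglaw)
    refine ((hHg.const_mul δ).norm).mono' (by fun_prop) (ae_of_all _ fun ω => ?_)
    rw [hh]
    split_ifs <;> simp only [Real.norm_eq_abs, mul_one, mul_zero, abs_zero]
    · exact le_of_eq (congrArg _ (by ring))
    · positivity
  have hind : IndepFun (fun ω => 4 * γ * |F (W ω)| ^ 3 + 8 * b ^ 2 * F (W ω) ^ 2)
      (fun ω => 1 + g ω ^ 4) P :=
    hWg.comp (φ := fun w => 4 * γ * |F w| ^ 3 + 8 * b ^ 2 * F w ^ 2)
      (ψ := fun z : ℝ => 1 + z ^ 4) (by fun_prop) (by fun_prop)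
  have iA : Integrable (fun ω => 4 * γ * |F (W ω)| ^ 3 + 8 * b ^ 2 * F (W ω) ^ 2) P :=
    (iF3.const_mul _).add (iF2.const_mul _)
  have iprod : Integrable (fun ω => (4 * γ * |F (W ω)| ^ 3 + 8 * b ^ 2 * F (W ω) ^ 2) *
    (1 + g ω ^ 4)) P := IndepFun.integrable_mul hind iA hg4
  have eprod := IndepFun.integral_fun_mul_eq_mul_integral hind iA.aestronglyMeasurable
    hg4.aestronglyMeasurable
  rw [integral_gaussian_pow_four hg hglaw] at eprod
  have i₁ : Integrable (fun ω => F (W ω) ^ 4 + 4 * (F (W ω) ^ 3 * c (W ω) * h ω)) P :=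
    hF.add (iHh.const_mul 4)
  have i₂ : Integrable (fun ω => F (W ω) ^ 4 + 4 * (F (W ω) ^ 3 * c (W ω) * h ω) +
      δ ^ 2 * ((4 * γ * |F (W ω)| ^ 3 + 8 * b ^ 2 * F (W ω) ^ 2) * (1 + g ω ^ 4))) P :=
    i₁.add (iprod.const_mul _)
  have i₃ : Integrable (fun ω => F (W ω) ^ 4 + 4 * (F (W ω) ^ 3 * c (W ω) * h ω) +
      δ ^ 2 * ((4 * γ * |F (W ω)| ^ 3 + 8 * b ^ 2 * F (W ω) ^ 2) * (1 + g ω ^ 4)) +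
      3 * b ^ 4 * δ ^ 4 * (1 + g ω ^ 4)) P := i₂.add (hg4.const_mul _)
  have hle : ∀ ω, (F (W ω) + r ω) ^ 4 ≤ F (W ω) ^ 4 + 4 * (F (W ω) ^ 3 * c (W ω) * h ω) +
      δ ^ 2 * ((4 * γ * |F (W ω)| ^ 3 + 8 * b ^ 2 * F (W ω) ^ 2) * (1 + g ω ^ 4)) +
      3 * b ^ 4 * δ ^ 4 * (1 + g ω ^ 4) := fun ω => by
    refine (add_pow_four_le (hr ω) (hrc ω)).trans ?_
    have h₁ := mul_le_mul_of_nonneg_left (hh2 ω)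
      (by positivity : 0 ≤ 4 * γ * |F (W ω)| ^ 3 + 8 * b ^ 2 * F (W ω) ^ 2)
    have h₂ := mul_le_mul_of_nonneg_left (hh4 ω) (by positivity : 0 ≤ 3 * b ^ 4)
    linarith
  have iF' : Integrable (fun ω => (F (W ω) + r ω) ^ 4) P :=
    i₃.mono' (by fun_prop) (ae_of_all _ fun ω => by
      rw [Real.norm_eq_abs, abs_of_nonneg (by positivity)]
      exact hle ω)
  refine ⟨iF', (integral_mono iF' i₃ hle).trans ?_⟩
  rw [integral_add i₂ (hg4.const_mul _), integral_add i₁ (iprod.const_mul _),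
    integral_add hF (iHh.const_mul 4), integral_const_mul, integral_const_mul, integral_const_mul,
    integral_gaussian_pow_four hg hglaw, eprod]
  have hdrift : ∫ ω, F (W ω) ^ 3 * c (W ω) * h ω ∂P ≤ δ ^ 2 * gaussM * (b * (1 + B * d) *
      ∫ ω, (|F (W ω)| ^ 3 * (|φ (x (W ω))| + 1) + F (W ω) ^ 2) ∂P) := by
    have e : ∫ ω, F (W ω) ^ 3 * c (W ω) * h ω ∂P = ∫ ω, F (W ω) ^ 3 * c (W ω) *
        (δ * g ω * (if u ω ≤ Real.exp (s (W ω) + (V (x (W ω)) -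
          V (x (W ω) + δ * g ω))) then 1 else 0)) ∂P := by simp_rw [hh]
    rw [e]
    refine (le_abs_self _).trans (drift.trans ?_)
    gcongr
    rw [← integral_const_mul]
    refine integral_mono_of_nonneg (ae_of_all _ fun ω => by positivity) ?_
      (ae_of_all _ fun ω => ?_)
    · refine Integrable.const_mul ?_ _
      refine ((iF3φ.add iF3).add iF2).congr (ae_of_all _ fun ω => ?_)
      simp only [Pi.add_apply]
      ring
    · dsimp only
      rw [abs_mul, abs_pow]
      calc |F (W ω)| ^ 3 * |c (W ω)| * (|φ (x (W ω))| + B * |δ|)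
          ≤ |F (W ω)| ^ 3 * b * (|φ (x (W ω))| + B * d) := by
            have := hc (W ω)
            gcongr
        _ ≤ |F (W ω)| ^ 3 * b * ((1 + B * d) * (|φ (x (W ω))| + 1)) := by
            gcongr
            nlinarith [mul_nonneg (mul_nonneg hB hd) (abs_nonneg (φ (x (W ω))))]
        _ ≤ b * (1 + B * d) * (|F (W ω)| ^ 3 * (|φ (x (W ω))| + 1) + F (W ω) ^ 2) := by
            have : 0 ≤ b * (1 + B * d) * F (W ω) ^ 2 := by positivity
            linarith
  have hsum : ∫ ω, (4 * γ * |F (W ω)| ^ 3 + 8 * b ^ 2 * F (W ω) ^ 2) ∂P ≤ (4 * γ + 8 * b ^ 2) *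
      ∫ ω, (|F (W ω)| ^ 3 * (|φ (x (W ω))| + 1) + F (W ω) ^ 2) ∂P := by
    rw [← integral_const_mul]
    refine integral_mono iA ?_ fun ω => ?_
    · refine Integrable.const_mul ?_ _
      refine ((iF3φ.add iF3).add iF2).congr (ae_of_all _ fun ω => ?_)
      simp only [Pi.add_apply]
      ring
    · dsimp only
      have h₁ : 0 ≤ |F (W ω)| ^ 3 * |φ (x (W ω))| := by positivity
      have h₂ : 0 ≤ |F (W ω)| ^ 3 := by positivity
      have h₃ : 0 ≤ F (W ω) ^ 2 := by positivity
      have h₄ : 0 ≤ b ^ 2 := by positivity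
      have h₅ := mul_nonneg hγ h₁
      have h₆ := mul_nonneg hγ h₃
      have h₇ := mul_nonneg h₄ h₁
      have h₈ := mul_nonneg h₄ h₂
      nlinarith
  have hI : 0 ≤ ∫ ω, (|F (W ω)| ^ 3 * (|φ (x (W ω))| + 1) + F (W ω) ^ 2) ∂P :=
    integral_nonneg fun ω => by positivity
  generalize ∫ ω, (|F (W ω)| ^ 3 * (|φ (x (W ω))| + 1) + F (W ω) ^ 2) ∂P = I at *
  have t₁ : 0 ≤ δ ^ 2 * gaussM * (3 * b ^ 4) * I := by positivity
  have t₂ : 0 ≤ δ ^ 4 * gaussM * (4 * b * (1 + B * d) + 4 * γ + 8 * b ^ 2) := by positivity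
  have t₃ := mul_le_mul_of_nonneg_left hsum (by positivity : 0 ≤ δ ^ 2 * gaussM)
  linarith

end OneStep

section Chaining

/-- The largest dyadic number of level `m` below `t`. -/
noncomputable def dyadicFloor (m : ℕ) (t : ℝ≥0) : ℝ≥0 := (⌊2 ^ m * t⌋₊ : ℝ≥0) / 2 ^ m

theorem tendsto_dyadicFloor (t : ℝ≥0) : Tendsto (fun m => dyadicFloor m t) atTop (𝓝 t) := by
  rw [← NNReal.tendsto_coe]
  have h := (tendsto_nat_floor_mul_div_atTop (R := ℝ) t.coe_nonneg).comp
    (tendsto_pow_atTop_atTop_of_one_lt (one_lt_two (α := ℝ)))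
  refine h.congr fun m => ?_
  simp only [Function.comp_apply, dyadicFloor, NNReal.coe_div, NNReal.coe_natCast, NNReal.coe_pow,
    NNReal.coe_ofNat]
  have e : ⌊(t : ℝ) * 2 ^ m⌋₊ = ⌊2 ^ m * t⌋₊ := by
    refine (Nat.floor_eq_iff (by positivity)).2 ⟨?_, ?_⟩
    · have := Nat.floor_le (show 0 ≤ 2 ^ m * t by positivity)
      rw [mul_comm (t : ℝ)]
      exact_mod_cast this
    · have := Nat.lt_floor_add_one (2 ^ m * t)
      rw [mul_comm (t : ℝ)]
      exact_mod_cast this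
  rw [e]

variable {f : ℝ≥0 → ℝ} {N : ℕ} {A : ℝ}

theorem abs_sub_dyadicFloor_succ_le (hA : 0 ≤ A)
    (hf : ∀ m i : ℕ, i < N * 2 ^ m →
      |f ((i + 1 : ℕ) / 2 ^ m) - f (i / 2 ^ m)| ≤ A * (9 / 10) ^ m)
    {t : ℝ≥0} (ht : t ≤ N) (m : ℕ) :
    |f (dyadicFloor (m + 1) t) - f (dyadicFloor m t)| ≤ A * (9 / 10) ^ (m + 1) := by
  unfold dyadicFloor
  set k := ⌊2 ^ m * t⌋₊ with hk
  set k' := ⌊2 ^ (m + 1) * t⌋₊ with hk'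
  have h₀ : ((2 * k : ℕ) : ℝ≥0) / 2 ^ (m + 1) = (k : ℝ≥0) / 2 ^ m := by
    push_cast
    rw [pow_succ', mul_div_mul_left _ _ two_ne_zero]
  have l₁ : 2 * k ≤ k' := by
    refine Nat.le_floor ?_
    push_cast
    rw [pow_succ', mul_assoc]
    gcongr
    exact Nat.floor_le (by positivity)
  have l₂ : k' < 2 * (k + 1) := by
    refine (Nat.floor_lt (by positivity)).2 ?_
    push_cast
    rw [pow_succ', mul_assoc]
    have := Nat.lt_floor_add_one (2 ^ m * t)
    gcongr
  rw [← h₀]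
  rcases (by omega : k' = 2 * k ∨ k' = 2 * k + 1) with h | h
  · rw [h, sub_self, abs_zero]
    positivity
  · rw [h]
    refine hf _ _ ?_
    have : (k' : ℝ≥0) ≤ N * 2 ^ (m + 1) := by
      refine (Nat.floor_le (by positivity)).trans ?_
      rw [mul_comm]
      gcongr
    have : k' ≤ N * 2 ^ (m + 1) := by exact_mod_cast this
    omega

theorem abs_sub_dyadicFloor_le (hfc : Continuous f) (hA : 0 ≤ A)
    (hf : ∀ m i : ℕ, i < N * 2 ^ m →
      |f ((i + 1 : ℕ) / 2 ^ m) - f (i / 2 ^ m)| ≤ A * (9 / 10) ^ m)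
    {t : ℝ≥0} (ht : t ≤ N) (m : ℕ) :
    |f t - f (dyadicFloor m t)| ≤ 9 * A * (9 / 10) ^ m := by
  have h : ∀ j, |f (dyadicFloor (j + m) t) - f (dyadicFloor m t)| ≤
      9 * A * (9 / 10) ^ m * (1 - (9 / 10) ^ j) := by
    intro j
    induction j with
    | zero => simp
    | succ j ih =>
      have h₁ := abs_sub_dyadicFloor_succ_le hA hf ht (j + m)
      rw [show j + m + 1 = j + 1 + m by ring] at h₁
      refine (abs_sub_le _ (f (dyadicFloor (j + m) t)) _).trans ((add_le_add h₁ ih).trans ?_)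
      have : 0 ≤ A * (9 / 10) ^ m * (9 / 10) ^ j := by positivity
      rw [pow_add, pow_succ]
      nlinarith
  have lim : Tendsto (fun j => |f (dyadicFloor (j + m) t) - f (dyadicFloor m t)|) atTop
      (𝓝 |f t - f (dyadicFloor m t)|) :=
    (((hfc.tendsto t).comp ((tendsto_dyadicFloor t).comp (tendsto_add_atTop_nat m))).sub_const
      _).abs
  refine le_of_tendsto' lim fun j => (h j).trans ?_
  have : 0 ≤ 9 * A * (9 / 10) ^ m := by positivity
  have h2 : (0 : ℝ) ≤ (9 / 10) ^ j := by positivity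
  nlinarith

/-- Bounds on the increments over dyadic intervals give a modulus of continuity. -/
theorem abs_sub_le_of_dyadic (hfc : Continuous f) (hA : 0 ≤ A)
    (hf : ∀ m i : ℕ, i < N * 2 ^ m →
      |f ((i + 1 : ℕ) / 2 ^ m) - f (i / 2 ^ m)| ≤ A * (9 / 10) ^ m)
    {m : ℕ} {s t : ℝ≥0} (hst : s ≤ t) (ht : t ≤ N) (hts : t ≤ s + 1 / 2 ^ m) :
    |f t - f s| ≤ 19 * A * (9 / 10) ^ m := by
  have h₁ := abs_sub_dyadicFloor_le hfc hA hf ht m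
  have h₂ := abs_sub_dyadicFloor_le hfc hA hf (hst.trans ht) m
  have h₃ : |f (dyadicFloor m t) - f (dyadicFloor m s)| ≤ A * (9 / 10) ^ m := by
    unfold dyadicFloor
    set k := ⌊2 ^ m * s⌋₊ with hk
    set k' := ⌊2 ^ m * t⌋₊ with hk'
    have l₁ : k ≤ k' := Nat.floor_mono (by gcongr)
    have l₂ : k' ≤ k + 1 := by
      rw [hk, ← Nat.floor_add_one (by positivity)]
      refine Nat.floor_mono ?_
      calc 2 ^ m * t ≤ 2 ^ m * (s + 1 / 2 ^ m) := by gcongr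
        _ = 2 ^ m * s + 1 := by field_simp
    rcases (by omega : k' = k ∨ k' = k + 1) with h | h
    · rw [h, sub_self, abs_zero]
      positivity
    · rw [h]
      refine hf _ _ ?_
      have : (k' : ℝ≥0) ≤ N * 2 ^ m := by
        refine (Nat.floor_le (by positivity)).trans ?_
        rw [mul_comm]
        gcongr
      have : k' ≤ N * 2 ^ m := by exact_mod_cast this
      omega
  rw [abs_le] at *
  constructor <;> linarith

end Chaining

section Compact

/-- Functions bounded by `R` at `0` and with modulus of continuity on `[0, N]` controlled by
`A N`. -/
def HolderControl (R : ℝ) (A : ℕ → ℝ) (f : ℝ≥0 → ℝ) : Prop :=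
  |f 0| ≤ R ∧ ∀ (N m : ℕ) (s t : ℝ≥0), s ≤ t → t ≤ N → t ≤ s + 1 / 2 ^ m →
    |f t - f s| ≤ 19 * A N * (9 / 10) ^ m

variable {R : ℝ} {A : ℕ → ℝ}

theorem HolderControl.exists_delta (A : ℕ → ℝ) (t₀ : ℝ≥0) {ε : ℝ} (hε : 0 < ε) :
    ∃ δ > 0, ∀ t, dist t t₀ < δ → ∀ (R : ℝ) (f : ℝ≥0 → ℝ), HolderControl R A f →
      |f t₀ - f t| < ε := by
  obtain ⟨N, hN⟩ := exists_nat_ge (t₀ + 1)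
  obtain ⟨m, hm⟩ : ∃ m : ℕ, 19 * A N * (9 / 10 : ℝ) ^ m < ε := by
    have h := (tendsto_pow_atTop_nhds_zero_of_lt_one (r := (9 / 10 : ℝ)) (by norm_num)
      (by norm_num)).const_mul (19 * A N)
    rw [mul_zero] at h
    exact (h.eventually_lt_const hε).exists
  refine ⟨1 / 2 ^ m, by positivity, fun t ht R f hf => ?_⟩
  rw [NNReal.dist_eq, abs_lt] at ht
  have h1 : (1 : ℝ) / 2 ^ m ≤ 1 := by
    rw [div_le_one (by positivity)]
    exact one_le_pow₀ one_le_two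
  rcases le_total t t₀ with h | h
  · refine (hf.2 N m t t₀ h (le_self_add.trans hN) ?_).trans_lt hm
    rw [← NNReal.coe_le_coe]
    push_cast
    linarith
  · rw [abs_sub_comm]
    refine (hf.2 N m t₀ t h (le_trans ?_ hN) ?_).trans_lt hm
    all_goals
      rw [← NNReal.coe_le_coe]
      push_cast
      linarith

theorem HolderControl.abs_le {f : ℝ≥0 → ℝ} (hf : HolderControl R A f) (N j : ℕ) (hj : j ≤ N)
    (t : ℝ≥0) (ht : t ≤ j) : |f t| ≤ R + j * (19 * A N) := by
  induction j generalizing t with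
  | zero =>
    have : t = 0 := by simpa using ht
    simpa [this] using hf.1
  | succ j ih =>
    have h₁ := ih (by omega) (t - 1) (by rw [tsub_le_iff_right]; exact_mod_cast ht)
    have h₂ := hf.2 N 0 (t - 1) t tsub_le_self (ht.trans (by exact_mod_cast hj))
      (by simpa using le_tsub_add)
    rw [pow_zero, mul_one] at h₂
    have h₃ := abs_sub_abs_le_abs_sub (f t) (f (t - 1))
    push_cast
    linarith

theorem isCompact_holderControl (R : ℝ) (A : ℕ → ℝ) :
    IsCompact {f : C(ℝ≥0, ℝ) | HolderControl R A f} := by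
  refine ArzelaAscoli.isCompact_of_equicontinuous _ ?_ ?_
  · have e : ContinuousMap.toFun '' {f : C(ℝ≥0, ℝ) | HolderControl R A f} =
        {f : ℝ≥0 → ℝ | HolderControl R A f} := by
      ext f
      constructor
      · rintro ⟨f, hf, rfl⟩
        exact hf
      · intro hf
        refine ⟨⟨f, Metric.continuous_iff.2 fun t₀ ε hε => ?_⟩, hf, rfl⟩
        obtain ⟨δ, hδ, h⟩ := HolderControl.exists_delta A t₀ hε
        refine ⟨δ, hδ, fun t ht => ?_⟩
        rw [dist_comm]
        exact h t ht R f hf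
    rw [e]
    have hcl : IsClosed {f : ℝ≥0 → ℝ | HolderControl R A f} := by
      simp only [HolderControl, Set.ofPred_and, Set.ofPred_forall]
      refine (isClosed_le (by fun_prop) continuous_const).inter ?_
      refine isClosed_iInter fun N => isClosed_iInter fun m => isClosed_iInter fun s =>
        isClosed_iInter fun t => isClosed_iInter fun _ => isClosed_iInter fun _ =>
        isClosed_iInter fun _ => isClosed_le (by fun_prop) continuous_const
    refine (isCompact_univ_pi fun t : ℝ≥0 => isCompact_Icc (a := -(R + ⌈t⌉₊ * (19 * A ⌈t⌉₊)))
      (b := R + ⌈t⌉₊ * (19 * A ⌈t⌉₊))).of_isClosed_subset hcl ?_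
    intro f hf t _
    exact _root_.abs_le.1 (hf.abs_le ⌈t⌉₊ ⌈t⌉₊ le_rfl t (Nat.le_ceil t))
  · intro t₀
    rw [Metric.equicontinuousAt_iff]
    intro ε hε
    obtain ⟨δ, hδ, h⟩ := HolderControl.exists_delta A t₀ hε
    exact ⟨δ, hδ, fun t ht f => h t ht R f f.2⟩

end Compact

section Tightness

variable {Ω : Type*} [MeasurableSpace Ω] {P : Measure Ω}

theorem measurable_eval_path (t : ℝ≥0) : Measurable fun f : C(ℝ≥0, ℝ) => f t :=
  (continuous_eval_const t).measurable

theorem measure_exists_dyadic_increment_gt_le {Z : Ω → C(ℝ≥0, ℝ)} (hZ : Measurable Z) {N : ℕ}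
    {C A e : ℝ} (hC : 0 ≤ C) (hA : 0 < A) (he : 5 * C * N ≤ e * A ^ 4)
    (hinc : ∀ s t : ℝ≥0, s ≤ t → t ≤ N →
      ∫⁻ ω, ENNReal.ofReal ((Z ω t - Z ω s) ^ 4) ∂P ≤ ENNReal.ofReal (C * ((t : ℝ) - s) ^ 2)) :
    P {ω | ∃ m i : ℕ, i < N * 2 ^ m ∧ A * (9 / 10) ^ m <
      |Z ω ((i + 1 : ℕ) / 2 ^ m) - Z ω (i / 2 ^ m)|} ≤ ENNReal.ofReal e := by
  have hZt : ∀ t, Measurable fun ω => Z ω t := fun t => (measurable_eval_path t).comp hZ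
  have markov : ∀ m i : ℕ, i < N * 2 ^ m →
      P {ω | A * (9 / 10) ^ m < |Z ω ((i + 1 : ℕ) / 2 ^ m) - Z ω (i / 2 ^ m)|} ≤
      ENNReal.ofReal (C * (1 / 2 ^ m) ^ 2 / (A * (9 / 10) ^ m) ^ 4) := by
    intro m i hi
    have hpos : 0 < (A * (9 / 10 : ℝ) ^ m) ^ 4 := by positivity
    have h := hinc (i / 2 ^ m) ((i + 1 : ℕ) / 2 ^ m) (by gcongr; simp) (by
      rw [div_le_iff₀ (by positivity)]
      exact_mod_cast hi)
    have hm₁ := hZt ((i + 1 : ℕ) / 2 ^ m)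
    have hm₂ := hZt (i / 2 ^ m)
    have hm := meas_ge_le_lintegral_div (μ := P) (f := fun ω => ENNReal.ofReal
        ((Z ω ((i + 1 : ℕ) / 2 ^ m) - Z ω (i / 2 ^ m)) ^ 4)) (by fun_prop)
        (ENNReal.ofReal_pos.2 hpos).ne' ENNReal.ofReal_ne_top
    rw [ENNReal.ofReal_div_of_pos hpos]
    refine (measure_mono fun ω hω => ?_).trans (hm.trans (ENNReal.div_le_div_right ?_ _))
    · refine ENNReal.ofReal_le_ofReal ?_
      rw [← abs_of_nonneg (by positivity :
        0 ≤ (Z ω ((i + 1 : ℕ) / 2 ^ m) - Z ω (i / 2 ^ m)) ^ 4), abs_pow]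
      have := le_of_lt (show A * (9 / 10) ^ m <
        |Z ω ((i + 1 : ℕ) / 2 ^ m) - Z ω (i / 2 ^ m)| from hω)
      gcongr
    · refine h.trans (le_of_eq ?_)
      congr 3
      push_cast
      ring
  have hsum : HasSum (fun m : ℕ => C * N / A ^ 4 * (4 / 5 : ℝ) ^ m) (C * N / A ^ 4 * 5) := by
    have := (hasSum_geometric_of_lt_one (r := (4 / 5 : ℝ)) (by norm_num) (by norm_num)).mul_left
      (C * N / A ^ 4)
    norm_num at this ⊢
    exact this
  calc P {ω | ∃ m i : ℕ, i < N * 2 ^ m ∧ A * (9 / 10) ^ m <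
        |Z ω ((i + 1 : ℕ) / 2 ^ m) - Z ω (i / 2 ^ m)|}
      ≤ P (⋃ m : ℕ, ⋃ i ∈ Finset.range (N * 2 ^ m), {ω | A * (9 / 10) ^ m <
        |Z ω ((i + 1 : ℕ) / 2 ^ m) - Z ω (i / 2 ^ m)|}) := by
        refine measure_mono ?_
        rintro ω ⟨m, i, hi, h⟩
        simp only [Set.mem_iUnion]
        exact ⟨m, i, Finset.mem_range.2 hi, h⟩
    _ ≤ ∑' m : ℕ, ENNReal.ofReal (C * N / A ^ 4 * (4 / 5 : ℝ) ^ m) := by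
        refine (measure_iUnion_le _).trans (ENNReal.tsum_le_tsum fun m => ?_)
        refine (measure_biUnion_finset_le _ _).trans ((Finset.sum_le_sum fun i hi =>
          markov m i (Finset.mem_range.1 hi)).trans ?_)
        rw [Finset.sum_const, Finset.card_range, nsmul_eq_mul, ← ENNReal.ofReal_natCast,
          ← ENNReal.ofReal_mul (by positivity)]
        refine ENNReal.ofReal_le_ofReal ?_
        have hq : ((10000 / 13122 : ℝ)) ^ m ≤ (4 / 5) ^ m := pow_le_pow_left₀ (by norm_num) (by norm_num) m
        have e₁ : (10000 / 13122 : ℝ) ^ m = 2 ^ m * (1 / 2 ^ m) ^ 2 / ((9 / 10) ^ m) ^ 4 := by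
          rw [← pow_mul, mul_comm m 4, pow_mul, one_div, ← inv_pow, ← pow_mul, mul_comm m 2,
            pow_mul, ← mul_pow, ← div_pow]
          norm_num
        calc ((N * 2 ^ m : ℕ) : ℝ) * (C * (1 / 2 ^ m) ^ 2 / (A * (9 / 10) ^ m) ^ 4)
            = C * N / A ^ 4 * (2 ^ m * (1 / 2 ^ m) ^ 2 / ((9 / 10) ^ m) ^ 4) := by
              push_cast
              field_simp
          _ ≤ C * N / A ^ 4 * (4 / 5) ^ m := by
              rw [← e₁]
              gcongr
    _ = ENNReal.ofReal (C * N / A ^ 4 * 5) := by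
        rw [← ENNReal.ofReal_tsum_of_nonneg (fun m => by positivity) hsum.summable, hsum.tsum_eq]
    _ ≤ ENNReal.ofReal e := by
        refine ENNReal.ofReal_le_ofReal ?_
        rw [div_mul_eq_mul_div, div_le_iff₀ (by positivity)]
        linarith

/-- Kolmogorov's tightness criterion for continuous real processes indexed by `ℝ≥0`. -/
theorem isTightMeasureSet_of_increments {ι : Type*} {Z : ι → Ω → C(ℝ≥0, ℝ)}
    (hZ : ∀ n, Measurable (Z n))
    (h₀ : IsTightMeasureSet (Set.range fun n => P.map fun ω => Z n ω 0))
    (hinc : ∀ N : ℕ, ∃ C : ℝ, 0 ≤ C ∧ ∀ n, ∀ s t : ℝ≥0, s ≤ t → t ≤ N →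
      ∫⁻ ω, ENNReal.ofReal ((Z n ω t - Z n ω s) ^ 4) ∂P ≤
        ENNReal.ofReal (C * ((t : ℝ) - s) ^ 2)) :
    IsTightMeasureSet (Set.range fun n => P.map (Z n)) := by
  rw [isTightMeasureSet_iff_exists_isCompact_measure_compl_le] at h₀ ⊢
  intro ε hε
  have hε2 : 0 < ε / 2 := ENNReal.half_pos hε.ne'
  obtain ⟨K₀, hK₀, hK₀'⟩ := h₀ (ε / 2) hε2
  obtain ⟨R, hR⟩ := hK₀.isBounded.subset_closedBall 0
  obtain ⟨e, he, hesum⟩ := ENNReal.exists_pos_sum_of_countable hε2.ne' ℕ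
  choose C hC hCinc using hinc
  have hAex : ∀ N : ℕ, ∃ A : ℝ, 0 < A ∧ 5 * C N * N ≤ e N * A ^ 4 := by
    intro N
    have heN : (0 : ℝ) < e N := he N
    refine ⟨max 1 (5 * C N * N / e N), by positivity, ?_⟩
    set A := max 1 (5 * C N * N / e N)
    have h1 : 1 ≤ A := le_max_left _ _
    have h2 : 5 * C N * N / e N ≤ A := le_max_right _ _
    rw [div_le_iff₀ heN] at h2
    have h4 : A ≤ A ^ 4 := le_self_pow₀ h1 (by norm_num)
    nlinarith
  choose A hA hAe using hAex
  have hKc := isCompact_holderControl R A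
  refine ⟨_, hKc, ?_⟩
  rintro _ ⟨n, rfl⟩
  dsimp only
  have hZ0 : Measurable fun ω => Z n ω 0 := (measurable_eval_path 0).comp (hZ n)
  rw [Measure.map_apply (hZ n) hKc.isClosed.measurableSet.compl]
  have hsub : Z n ⁻¹' {f : C(ℝ≥0, ℝ) | HolderControl R A f}ᶜ ⊆
      ((fun ω => Z n ω 0) ⁻¹' K₀ᶜ) ∪ ⋃ N : ℕ, {ω | ∃ m i : ℕ, i < N * 2 ^ m ∧
        A N * (9 / 10) ^ m < |Z n ω ((i + 1 : ℕ) / 2 ^ m) - Z n ω (i / 2 ^ m)|} := by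
    intro ω hω
    by_contra hcon
    simp only [Set.mem_union, Set.mem_preimage, Set.mem_compl_iff, not_or, not_not,
      Set.mem_iUnion, Set.mem_ofPred_eq, not_exists, not_and, not_lt] at hcon
    refine hω ⟨by simpa using hR hcon.1, fun N m s t hst ht hts => ?_⟩
    exact abs_sub_le_of_dyadic (Z n ω).continuous (hA N).le (fun m i hi => hcon.2 N m i hi)
      hst ht hts
  calc P (Z n ⁻¹' {f : C(ℝ≥0, ℝ) | HolderControl R A f}ᶜ)
      ≤ P ((fun ω => Z n ω 0) ⁻¹' K₀ᶜ) + ∑' N : ℕ, (e N : ℝ≥0∞) := by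
        refine (measure_mono hsub).trans ((measure_union_le _ _).trans ?_)
        refine add_le_add le_rfl ((measure_iUnion_le _).trans (ENNReal.tsum_le_tsum fun N => ?_))
        refine (measure_exists_dyadic_increment_gt_le (hZ n) (hC N) (hA N) (hAe N)
          (hCinc N n)).trans (le_of_eq ?_)
        simp
    _ ≤ ε / 2 + ε / 2 := by
        refine add_le_add ?_ hesum.le
        rw [← Measure.map_apply hZ0 hK₀.isClosed.measurableSet.compl]
        exact hK₀' _ ⟨n, rfl⟩
    _ = ε := ENNReal.add_halves ε

end Tightness

section Potential

/-- Bounds on a potential implied by bounds on its second and third derivatives. -/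
structure PotentialBounds (V : ℝ → ℝ) (B : ℝ) : Prop where
  measurable : Measurable V
  measurable_deriv : Measurable (deriv V)
  measurable_deriv2 : Measurable (deriv (deriv V))
  nonneg : 0 ≤ B
  abs_sub_le : ∀ y h, |V (y + h) - V y| ≤ |deriv V y| * |h| + B * h ^ 2
  abs_deriv2_le : ∀ y, |deriv (deriv V) y| ≤ B
  abs_deriv_sub_le : ∀ y h, |deriv V (y + h) - deriv V y| ≤ B * |h|
  abs_deriv_taylor_le : ∀ y h, |deriv V (y + h) - deriv V y - deriv (deriv V) y * h| ≤ B * h ^ 2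

theorem abs_sub_le_of_deriv_le {f : ℝ → ℝ} {B : ℝ} (hf : Differentiable ℝ f)
    (hB : ∀ y, |deriv f y| ≤ B) (y h : ℝ) : |f (y + h) - f y| ≤ B * |h| := by
  have := convex_univ.norm_image_sub_le_of_norm_deriv_le (f := f) (C := B) (x := y) (y := y + h)
    (fun z _ => hf z) (fun z _ => hB z) trivial trivial
  simpa using this

theorem abs_taylor_le_of_deriv2_le {f : ℝ → ℝ} {B : ℝ} (hf : Differentiable ℝ f)
    (hf' : Differentiable ℝ (deriv f)) (hB : ∀ y, |deriv (deriv f) y| ≤ B) (y h : ℝ) :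
    |f (y + h) - f y - deriv f y * h| ≤ B * h ^ 2 := by
  have hB0 : 0 ≤ B := (abs_nonneg _).trans (hB 0)
  have hd : ∀ z, HasDerivAt (fun z => f z - deriv f y * z) (deriv f z - deriv f y) z := fun z => by
    exact ((hf z).hasDerivAt.fun_sub ((hasDerivAt_id' z).const_mul (deriv f y))).congr_deriv
      (by simp)
  have := (convex_uIcc y (y + h)).norm_image_sub_le_of_norm_hasDerivWithin_le
    (C := B * |h|) (x := y) (y := y + h)
    (fun z _ => (hd z).hasDerivWithinAt) (fun z hz => ?_) Set.left_mem_uIcc Set.right_mem_uIcc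
  · calc |f (y + h) - f y - deriv f y * h|
        = ‖f (y + h) - deriv f y * (y + h) - (f y - deriv f y * y)‖ := by
          rw [Real.norm_eq_abs]
          congr 1
          ring
      _ ≤ B * |h| * ‖y + h - y‖ := this
      _ = B * h ^ 2 := by
          rw [add_sub_cancel_left, Real.norm_eq_abs, mul_assoc, ← sq, sq_abs]
  · have h₁ := abs_sub_le_of_deriv_le hf' hB y (z - y)
    rw [add_sub_cancel] at h₁
    have h₂ := Set.abs_sub_left_of_mem_uIcc hz
    rw [add_sub_cancel_left] at h₂
    exact h₁.trans (mul_le_mul_of_nonneg_left h₂ hB0)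

theorem exists_potentialBounds {V : ℝ → ℝ} (hV : ContDiff ℝ 3 V)
    (hV2 : ∃ B : ℝ, ∀ x, |iteratedDeriv 2 V x| ≤ B)
    (hV3 : ∃ B : ℝ, ∀ x, |iteratedDeriv 3 V x| ≤ B) : ∃ B, PotentialBounds V B := by
  obtain ⟨B₂, hB₂⟩ := hV2
  obtain ⟨B₃, hB₃⟩ := hV3
  have e₂ : iteratedDeriv 2 V = deriv (deriv V) := by
    rw [iteratedDeriv_succ, iteratedDeriv_one]
  have e₃ : iteratedDeriv 3 V = deriv (deriv (deriv V)) := by rw [iteratedDeriv_succ, e₂]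
  rw [e₂] at hB₂
  rw [e₃] at hB₃
  have hd₁ : ContDiff ℝ 2 (deriv V) := by
    have : ContDiff ℝ (2 + 1) V := hV
    exact (contDiff_succ_iff_deriv.1 this).2.2
  have hd₂ : ContDiff ℝ 1 (deriv (deriv V)) := by
    have : ContDiff ℝ (1 + 1) (deriv V) := hd₁
    exact (contDiff_succ_iff_deriv.1 this).2.2
  have D₀ : Differentiable ℝ V := hV.differentiable (by norm_num)
  have D₁ : Differentiable ℝ (deriv V) := hd₁.differentiable (by norm_num)
  have D₂ : Differentiable ℝ (deriv (deriv V)) := hd₂.differentiable (by norm_num)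
  have h₂ : ∀ y, |deriv (deriv V) y| ≤ max B₂ B₃ := fun y => (hB₂ y).trans (le_max_left _ _)
  have h₃ : ∀ y, |deriv (deriv (deriv V)) y| ≤ max B₂ B₃ :=
    fun y => (hB₃ y).trans (le_max_right _ _)
  refine ⟨max B₂ B₃, ⟨hV.continuous.measurable, hd₁.continuous.measurable,
    hd₂.continuous.measurable, (abs_nonneg _).trans (h₂ 0), fun y h => ?_, h₂,
    abs_sub_le_of_deriv_le D₁ h₂, abs_taylor_le_of_deriv2_le D₁ D₂ h₃⟩⟩
  have := abs_taylor_le_of_deriv2_le D₀ D₁ h₂ y h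
  rw [← abs_mul]
  calc |V (y + h) - V y| = |deriv V y * h + (V (y + h) - V y - deriv V y * h)| := by
        congr 1
        ring
    _ ≤ _ := (abs_add_le _ _).trans (add_le_add le_rfl this)

end Potential

section Chain

theorem measurable_step {Ω : Type*} [MeasurableSpace Ω] {V : ℝ → ℝ} (hV : Measurable V) (l : ℝ)
    {n : ℕ} {X : Ω → Fin n → ℝ} {g : Ω → Fin n → ℝ} {u : Ω → ℝ} (hX : Measurable X)
    (hg : Measurable g) (hu : Measurable u) : Measurable fun ω => step V l (X ω) (g ω) (u ω) := by
  have hXi : ∀ i, Measurable fun ω => X ω i := fun i => (measurable_pi_apply i).comp hX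
  have hgi : ∀ i, Measurable fun ω => g ω i := fun i => (measurable_pi_apply i).comp hg
  refine measurable_pi_lambda _ fun i => ?_
  unfold step
  refine (hXi i).add (((hgi i).const_mul _).mul (Measurable.ite ?_ measurable_const
    measurable_const))
  refine measurableSet_le hu (Real.measurable_exp.comp (Finset.measurable_sum _ fun j _ => ?_))
  exact (hV.comp (hXi j)).sub (hV.comp ((hXi j).add ((hgi j).const_mul _)))

theorem measurable_chain {Ω : Type*} [MeasurableSpace Ω] {V : ℝ → ℝ} (hV : Measurable V) (l : ℝ)
    {n : ℕ} {X₀ : Ω → Fin n → ℝ} {G : ℕ → ℕ → Ω → ℝ} {U : ℕ → Ω → ℝ} (hX : Measurable X₀) (k : ℕ)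
    (hG : ∀ i < n, ∀ j < k, Measurable (G i j)) (hU : ∀ j < k, Measurable (U j)) :
    Measurable (chain V l X₀ G U k) := by
  induction k with
  | zero => exact hX
  | succ k ih =>
    exact measurable_step hV l
      (ih (fun i hi j hj => hG i hi j (by omega)) fun j hj => hU j (by omega))
      (measurable_pi_lambda _ fun i => hG i i.2 k (by omega)) (hU k (by omega))

/-- The standing assumptions on the initial condition and the noise. -/
structure IsInput {Ω : Type*} [MeasurableSpace Ω] (P : Measure Ω) {n : ℕ} (X₀ : Ω → Fin n → ℝ)
    (G : ℕ → ℕ → Ω → ℝ) (U : ℕ → Ω → ℝ) : Prop where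
  measurable_G : ∀ i k, Measurable (G i k)
  measurable_U : ∀ k, Measurable (U k)
  measurable_X : Measurable X₀
  map_G : ∀ i k, P.map (G i k) = gaussianReal 0 1
  map_U : ∀ k, P.map (U k) = volume.restrict (Set.Icc (0 : ℝ) 1)
  iIndepFun_G : iIndepFun (fun (p : ℕ × ℕ) ω => G p.1 p.2 ω) P
  iIndepFun_U : iIndepFun U P
  indepFun_GU : IndepFun (fun ω (p : ℕ × ℕ) => G p.1 p.2 ω) (fun ω k => U k ω) P
  indepFun_X : IndepFun X₀ (fun ω => ((fun p : ℕ × ℕ => G p.1 p.2 ω), (fun k : ℕ => U k ω))) P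

/-- Indices of the Gaussian variables used up to the transition from time `k`, except that of the
first coordinate in this transition. -/
def pastIdx (n k : ℕ) : Finset (ℕ × ℕ) := (Finset.range n ×ˢ Finset.range (k + 1)).erase (0, k)

/-- The variables on which the transition of the first coordinate from time `k` depends, except
for its own Gaussian increment and the uniform variable. -/
def past {Ω : Type*} {n : ℕ} (X₀ : Ω → Fin n → ℝ) (G : ℕ → ℕ → Ω → ℝ) (U : ℕ → Ω → ℝ) (k : ℕ)
    (ω : Ω) : ((pastIdx n k → ℝ) × (Finset.range k → ℝ)) × (Fin n → ℝ) :=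
  ((fun p => G p.1.1 p.1.2 ω, fun j => U j ω), X₀ ω)

variable {Ω : Type*} [MeasurableSpace Ω] {P : Measure Ω} [IsProbabilityMeasure P]
  {n : ℕ} {X₀ : Ω → Fin n → ℝ} {G : ℕ → ℕ → Ω → ℝ} {U : ℕ → Ω → ℝ}

omit [IsProbabilityMeasure P] in
theorem IsInput.measurable_past (h : IsInput P X₀ G U) (k : ℕ) : Measurable (past X₀ G U k) :=
  ((measurable_pi_lambda _ fun _ => h.measurable_G _ _).prodMk
    (measurable_pi_lambda _ fun _ => h.measurable_U _)).prodMk h.measurable_X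

theorem IsInput.indepFun_past_G (h : IsInput P X₀ G U) (k : ℕ) :
    IndepFun (past X₀ G U k) (G 0 k) P := by
  have mA : Measurable fun ω (p : pastIdx n k) => G p.1.1 p.1.2 ω :=
    measurable_pi_lambda _ fun _ => h.measurable_G _ _
  have mC : Measurable fun ω (j : Finset.range k) => U j ω :=
    measurable_pi_lambda _ fun _ => h.measurable_U _
  have hBA : IndepFun (G 0 k) (fun ω (p : pastIdx n k) => G p.1.1 p.1.2 ω) P :=
    (h.iIndepFun_G.indepFun_finset {(0, k)} (pastIdx n k) (by simp [pastIdx])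
      (fun p => h.measurable_G _ _)).comp
      (φ := fun v : ({(0, k)} : Finset (ℕ × ℕ)) → ℝ => v ⟨(0, k), by simp⟩)
      (measurable_pi_apply _) measurable_id
  have hBAC := indepFun_prodMk_right (h.measurable_G 0 k) mA mC hBA
    (h.indepFun_GU.comp (φ := fun v => (v (0, k), fun p : pastIdx n k => v p))
      (ψ := fun v (j : Finset.range k) => v j) (by fun_prop) (by fun_prop))
  exact (indepFun_prodMk_right (h.measurable_G 0 k) (mA.prodMk mC) h.measurable_X hBAC
    (h.indepFun_X.symm.comp
      (φ := fun v => (v.1 (0, k), (fun p : pastIdx n k => v.1 p, fun j : Finset.range k => v.2 j)))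
      (by fun_prop) measurable_id)).symm

theorem IsInput.indepFun_past_U (h : IsInput P X₀ G U) (k : ℕ) :
    IndepFun (fun ω => (past X₀ G U k ω, G 0 k ω)) (U k) P := by
  have mA : Measurable fun ω (p : pastIdx n k) => G p.1.1 p.1.2 ω :=
    measurable_pi_lambda _ fun _ => h.measurable_G _ _
  have mC : Measurable fun ω (j : Finset.range k) => U j ω :=
    measurable_pi_lambda _ fun _ => h.measurable_U _
  have hDC : IndepFun (U k) (fun ω (j : Finset.range k) => U j ω) P :=
    (h.iIndepFun_U.indepFun_finset {k} (Finset.range k) (by simp)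
      (fun p => h.measurable_U _)).comp
      (φ := fun v : ({k} : Finset ℕ) → ℝ => v ⟨k, by simp⟩) (measurable_pi_apply _) measurable_id
  have hDCAB := indepFun_prodMk_right (h.measurable_U k) mC (mA.prodMk (h.measurable_G 0 k)) hDC
    (h.indepFun_GU.symm.comp (φ := fun v => (v k, fun j : Finset.range k => v j))
      (ψ := fun v => (fun p : pastIdx n k => v p, v (0, k))) (by fun_prop) (by fun_prop))
  have hall := indepFun_prodMk_right (h.measurable_U k)
    (mC.prodMk (mA.prodMk (h.measurable_G 0 k))) h.measurable_X hDCAB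
    (h.indepFun_X.symm.comp
      (φ := fun v => (v.2 k, (fun j : Finset.range k => v.2 j,
        (fun p : pastIdx n k => v.1 p, v.1 (0, k))))) (by fun_prop) measurable_id)
  exact hall.symm.comp (φ := fun v => (((v.1.2.1, v.1.1), v.2), v.1.2.2)) (by fun_prop)
    measurable_id

/-- The contribution of the coordinates other than the first one to the acceptance exponent. -/
noncomputable def otherExponent (V : ℝ → ℝ) (l : ℝ) (n : ℕ+) (X₀ : Ω → Fin n → ℝ)
    (G : ℕ → ℕ → Ω → ℝ) (U : ℕ → Ω → ℝ) (k : ℕ) (ω : Ω) : ℝ :=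
  ∑ i ∈ Finset.univ.erase (first n), (V (chain V l X₀ G U k ω i) -
    V (chain V l X₀ G U k ω i + l / √((n : ℕ) : ℝ) * G i k ω))

omit [MeasurableSpace Ω] in
theorem chain_succ_first (V : ℝ → ℝ) (l : ℝ) (n : ℕ+) (X₀ : Ω → Fin n → ℝ)
    (G : ℕ → ℕ → Ω → ℝ) (U : ℕ → Ω → ℝ) (k : ℕ) (ω : Ω) :
    chain V l X₀ G U (k + 1) ω (first n) = chain V l X₀ G U k ω (first n) +
      l / √((n : ℕ) : ℝ) * G 0 k ω * (if U k ω ≤ Real.exp (otherExponent V l n X₀ G U k ω +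
        (V (chain V l X₀ G U k ω (first n)) - V (chain V l X₀ G U k ω (first n) +
          l / √((n : ℕ) : ℝ) * G 0 k ω))) then 1 else 0) := by
  have e := Finset.sum_erase_add Finset.univ (fun i => V (chain V l X₀ G U k ω i) -
    V (chain V l X₀ G U k ω i + l / √((n : ℕ) : ℝ) * G i k ω)) (Finset.mem_univ (first n))
  simp only [chain, step, Accepted, ← e, otherExponent]
  rfl

variable {V : ℝ → ℝ} {l : ℝ}

omit [MeasurableSpace Ω] in
theorem measurable_comap_past {n : ℕ} {X₀ : Ω → Fin n → ℝ} (k : ℕ) :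
    Measurable[MeasurableSpace.comap (past X₀ G U k) inferInstance] X₀ ∧
    (∀ p ∈ pastIdx n k,
      Measurable[MeasurableSpace.comap (past X₀ G U k) inferInstance] (G p.1 p.2)) ∧
    ∀ j < k, Measurable[MeasurableSpace.comap (past X₀ G U k) inferInstance] (U j) := by
  have hp : Measurable[MeasurableSpace.comap (past X₀ G U k) inferInstance] (past X₀ G U k) :=
    comap_measurable _
  refine ⟨measurable_snd.comp hp, fun p hp' => ?_, fun j hj => ?_⟩
  · exact ((measurable_pi_apply (⟨p, hp'⟩ : pastIdx n k)).comp
      (measurable_fst.comp measurable_fst)).comp hp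
  · exact ((measurable_pi_apply (⟨j, Finset.mem_range.2 hj⟩ : Finset.range k)).comp
      (measurable_snd.comp measurable_fst)).comp hp

omit [MeasurableSpace Ω] in
theorem exists_chain_eq_past (hV : Measurable V) (l : ℝ) {n : ℕ+} (X₀ : Ω → Fin n → ℝ)
    (G : ℕ → ℕ → Ω → ℝ) (U : ℕ → Ω → ℝ) {m k : ℕ} (hmk : m ≤ k) :
    ∃ χ : ((pastIdx n k → ℝ) × (Finset.range k → ℝ)) × (Fin n → ℝ) → (Fin n → ℝ),
      Measurable χ ∧ ∀ ω, chain V l X₀ G U m ω = χ (past X₀ G U k ω) := by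
  obtain ⟨hX, hG, hU⟩ := measurable_comap_past (G := G) (U := U) (X₀ := X₀) k
  have h := @measurable_chain Ω (MeasurableSpace.comap (past X₀ G U k) inferInstance) V hV l n X₀
    G U hX m (fun i hi j hj => hG (i, j) (by
      simp only [pastIdx, Finset.mem_erase, Finset.mem_product, Finset.mem_range, ne_eq,
        Prod.mk.injEq]
      omega)) (fun j hj => hU j (by omega))
  obtain ⟨χ, hχ, e⟩ := h.exists_eq_measurable_comp
  exact ⟨χ, hχ, fun ω => congrFun e ω⟩

omit [MeasurableSpace Ω] in
theorem exists_otherExponent_eq_past (hV : Measurable V) (l : ℝ) {n : ℕ+} (X₀ : Ω → Fin n → ℝ)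
    (G : ℕ → ℕ → Ω → ℝ) (U : ℕ → Ω → ℝ) (k : ℕ) :
    ∃ s : ((pastIdx n k → ℝ) × (Finset.range k → ℝ)) × (Fin n → ℝ) → ℝ,
      Measurable s ∧ ∀ ω, otherExponent V l n X₀ G U k ω = s (past X₀ G U k ω) := by
  obtain ⟨-, hG, -⟩ := measurable_comap_past (G := G) (U := U) (X₀ := X₀) k
  obtain ⟨χ, hχ, e⟩ := exists_chain_eq_past hV l X₀ G U le_rfl (k := k)
  have h : Measurable[MeasurableSpace.comap (past X₀ G U k) inferInstance]
      (otherExponent V l n X₀ G U k) := by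
    refine Finset.measurable_sum _ fun i hi => ?_
    have h₁ : Measurable[MeasurableSpace.comap (past X₀ G U k) inferInstance]
        fun ω => chain V l X₀ G U k ω i := by
      simp_rw [e]
      exact ((measurable_pi_apply i).comp hχ).comp (comap_measurable _)
    have h₂ := hG (i, k) (by
      have : (i : ℕ) ≠ 0 := fun h0 => (Finset.mem_erase.1 hi).1 (Fin.ext h0)
      simp only [pastIdx, Finset.mem_erase, Finset.mem_product, Finset.mem_range, ne_eq,
        Prod.mk.injEq]
      have := i.2
      omega)
    exact (hV.comp h₁).sub (hV.comp (h₁.add (h₂.const_mul _)))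
  obtain ⟨s, hs, e⟩ := h.exists_eq_measurable_comp
  exact ⟨s, hs, fun ω => congrFun e ω⟩

end Chain

section Moments

variable {Ω : Type*} [MeasurableSpace Ω] {P : Measure Ω} [IsProbabilityMeasure P]
  {V : ℝ → ℝ} {l B : ℝ} {n : ℕ+} {X₀ : Ω → Fin n → ℝ} {G : ℕ → ℕ → Ω → ℝ} {U : ℕ → Ω → ℝ}

omit [IsProbabilityMeasure P] in
theorem IsInput.measurable_chain_first (h : IsInput P X₀ G U) (hV : Measurable V) (k : ℕ) :
    Measurable fun ω => chain V l X₀ G U k ω (first n) :=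
  (measurable_pi_apply _).comp (measurable_chain hV l h.measurable_X k
    (fun _ _ _ _ => h.measurable_G _ _) fun _ _ => h.measurable_U _)

theorem sq_div_sqrt (l : ℝ) (n : ℕ+) : (l / √((n : ℕ) : ℝ)) ^ 2 = l ^ 2 / n := by
  rw [div_pow, Real.sq_sqrt (by positivity)]

theorem pow_four_div_sqrt (l : ℝ) (n : ℕ+) : (l / √((n : ℕ) : ℝ)) ^ 4 = l ^ 4 / (n : ℝ) ^ 2 := by
  rw [show (l / √((n : ℕ) : ℝ)) ^ 4 = ((l / √((n : ℕ) : ℝ)) ^ 2) ^ 2 by ring, sq_div_sqrt, div_pow]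
  ring

theorem one_le_cast (n : ℕ+) : (1 : ℝ) ≤ n := by exact_mod_cast n.pos

theorem abs_div_sqrt_le (l : ℝ) (n : ℕ+) : |l / √((n : ℕ) : ℝ)| ≤ |l| := by
  rw [abs_div, abs_of_nonneg (Real.sqrt_nonneg _)]
  exact div_le_self (abs_nonneg _) (Real.one_le_sqrt.2 (one_le_cast n))

/-- The constant in the one-step bound for the fourth moment of a functional of the chain. -/
noncomputable def stepConst (l B b γ : ℝ) : ℝ :=
  gaussM * (4 * b * (1 + B * |l|) + 4 * γ + 8 * b ^ 2 + 3 * b ^ 4)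

theorem stepConst_nonneg {l B b γ : ℝ} (hB : 0 ≤ B) (hb : 0 ≤ b) (hγ : 0 ≤ γ) :
    0 ≤ stepConst l B b γ := by
  have := gaussM_nonneg
  unfold stepConst
  positivity

theorem IsInput.moment_step (h : IsInput P X₀ G U) (hV : PotentialBounds V B) (k : ℕ)
    (hint : Integrable (fun ω => deriv V (chain V l X₀ G U k ω (first n)) ^ 4) P) :
    Integrable (fun ω => deriv V (chain V l X₀ G U (k + 1) ω (first n)) ^ 4) P ∧
    ∫ ω, deriv V (chain V l X₀ G U (k + 1) ω (first n)) ^ 4 ∂P + 1 ≤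
      (∫ ω, deriv V (chain V l X₀ G U k ω (first n)) ^ 4 ∂P + 1) *
        (1 + stepConst l B B B * (3 * l ^ 2 + l ^ 4) / n) := by
  obtain ⟨χ, hχ, eχ⟩ := exists_chain_eq_past hV.measurable l X₀ G U (le_refl k)
  obtain ⟨s, hs, es⟩ := exists_otherExponent_eq_past hV.measurable l X₀ G U k
  have mk := h.measurable_chain_first (l := l) hV.measurable k
  have mk' := h.measurable_chain_first (l := l) hV.measurable (k + 1)
  have md := hV.measurable_deriv
  have mx : Measurable fun w => χ w (first n) := (measurable_pi_apply _).comp hχ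
  set X : Ω → ℝ := fun ω => chain V l X₀ G U k ω (first n) with hX
  set X' : Ω → ℝ := fun ω => chain V l X₀ G U (k + 1) ω (first n) with hX'
  have eX : ∀ ω, χ (past X₀ G U k ω) (first n) = X ω := fun ω => by rw [← eχ]
  obtain ⟨hi, hle⟩ := integral_add_pow_four_le (h.measurable_past k) (h.measurable_G 0 k)
    (h.measurable_U k) (h.indepFun_past_G k) (h.indepFun_past_U k) (h.map_G 0 k) (h.map_U k)
    hV.measurable md hV.nonneg hV.abs_sub_le mx hs (abs_div_sqrt_le l n)
    (F := fun w => deriv V (χ w (first n))) (c := fun w => deriv (deriv V) (χ w (first n)))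
    (md.comp mx) (hV.measurable_deriv2.comp mx) (b := B) (γ := B) hV.nonneg
    (r := fun ω => deriv V (X' ω) - deriv V (X ω)) (h := fun ω => X' ω - X ω)
    (fun ω => by
      simp only [hX', chain_succ_first, ← es, eX]
      simp only [hX]
      ring)
    ((md.comp mk').sub (md.comp mk)) (fun w => hV.abs_deriv2_le _)
    (fun ω => by simpa using hV.abs_deriv_sub_le (X ω) (X' ω - X ω))
    (fun ω => by simpa [eX] using hV.abs_deriv_taylor_le (X ω) (X' ω - X ω))
    (by simpa only [eX] using hint) (by simpa only [eX] using hint)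
  simp only [eX, add_sub_cancel] at hi hle
  refine ⟨hi, ?_⟩
  change _ ≤ _ + _ * stepConst l B B B * _ + _ * stepConst l B B B at hle
  rw [sq_div_sqrt, pow_four_div_sqrt] at hle
  have hK := stepConst_nonneg (l := l) hV.nonneg hV.nonneg hV.nonneg
  set K := stepConst l B B B
  change Integrable (fun ω => deriv V (X ω) ^ 4) P at hint
  change ∫ ω, deriv V (X' ω) ^ 4 ∂P + 1 ≤ (∫ ω, deriv V (X ω) ^ 4 ∂P + 1) * _
  have hbound : ∫ ω, (|deriv V (X ω)| ^ 3 * (|deriv V (X ω)| + 1) + deriv V (X ω) ^ 2) ∂P ≤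
      3 * (∫ ω, deriv V (X ω) ^ 4 ∂P + 1) := by
    have e : 3 * (∫ ω, deriv V (X ω) ^ 4 ∂P + 1) = ∫ ω, 3 * (deriv V (X ω) ^ 4 + 1) ∂P := by
      rw [integral_const_mul, integral_add hint (integrable_const _)]
      simp
    rw [e]
    refine integral_mono_of_nonneg (ae_of_all _ fun ω => by positivity)
      ((hint.add (integrable_const 1)).const_mul 3) (ae_of_all _ fun ω => ?_)
    dsimp only
    have h₁ := sq_le_one_add_pow_four (deriv V (X ω))
    have h₂ := abs_pow_three_le_one_add_pow_four (deriv V (X ω))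
    have h₃ : |deriv V (X ω)| ^ 3 * |deriv V (X ω)| = deriv V (X ω) ^ 4 := by
      rw [← pow_succ, Even.pow_abs (by decide)]
    nlinarith
  have hI : 0 ≤ ∫ ω, deriv V (X ω) ^ 4 ∂P := integral_nonneg fun ω => by positivity
  set a := ∫ ω, deriv V (X ω) ^ 4 ∂P
  have hn := one_le_cast n
  have h₁ : l ^ 4 / (n : ℝ) ^ 2 * K ≤ (a + 1) * (K * l ^ 4 / n) := by
    have e₁ : l ^ 4 / (n : ℝ) ^ 2 * K ≤ K * l ^ 4 / n := by
      rw [mul_comm, ← mul_div_assoc]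
      gcongr
      nlinarith
    have e₂ : 0 ≤ K * l ^ 4 / n := by positivity
    nlinarith
  have h₂ := mul_le_mul_of_nonneg_left hbound (by positivity : 0 ≤ l ^ 2 / (n : ℝ) * K)
  have e : (a + 1) * (1 + K * (3 * l ^ 2 + l ^ 4) / n) =
      a + 1 + l ^ 2 / n * K * (3 * (a + 1)) + (a + 1) * (K * l ^ 4 / n) := by ring
  rw [e]
  linarith

theorem IsInput.moment_bound (h : IsInput P X₀ G U) (hV : PotentialBounds V B)
    (hint : Integrable (fun ω => deriv V (X₀ ω (first n)) ^ 4) P) (k : ℕ) :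
    Integrable (fun ω => deriv V (chain V l X₀ G U k ω (first n)) ^ 4) P ∧
    ∫ ω, deriv V (chain V l X₀ G U k ω (first n)) ^ 4 ∂P + 1 ≤
      (∫ ω, deriv V (X₀ ω (first n)) ^ 4 ∂P + 1) *
        Real.exp (stepConst l B B B * (3 * l ^ 2 + l ^ 4) * (k / n)) := by
  induction k with
  | zero => exact ⟨hint, by simp [chain]⟩
  | succ k ih =>
    obtain ⟨hi, hle⟩ := h.moment_step hV k ih.1
    refine ⟨hi, hle.trans ?_⟩
    have hI : 0 ≤ ∫ ω, deriv V (X₀ ω (first n)) ^ 4 ∂P := integral_nonneg fun ω => by positivity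
    have hK := stepConst_nonneg (l := l) hV.nonneg hV.nonneg hV.nonneg
    set K := stepConst l B B B
    have he := Real.add_one_le_exp (K * (3 * l ^ 2 + l ^ 4) / n)
    have hn := one_le_cast n
    calc _ ≤ (∫ ω, deriv V (X₀ ω (first n)) ^ 4 ∂P + 1) *
          Real.exp (K * (3 * l ^ 2 + l ^ 4) * (k / n)) *
          Real.exp (K * (3 * l ^ 2 + l ^ 4) / n) :=
          mul_le_mul ih.2 (by linarith) (by positivity) (by positivity)
      _ = _ := by
          rw [mul_assoc, ← Real.exp_add]
          congr 2
          push_cast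
          ring

theorem young_cubic {y q : ℝ} (hy : 0 ≤ y) (hq : 0 ≤ q) : y ^ 3 * q ≤ y ^ 4 / 2 + 8 * q ^ 4 := by
  rcases le_total q (y / 2) with h | h
  · calc y ^ 3 * q ≤ y ^ 3 * (y / 2) := by gcongr
      _ ≤ y ^ 4 / 2 + 8 * q ^ 4 := by
        have : 0 ≤ q ^ 4 := by positivity
        linarith
  · calc y ^ 3 * q ≤ (2 * q) ^ 3 * q := by gcongr; linarith
      _ ≤ y ^ 4 / 2 + 8 * q ^ 4 := by
        have : 0 ≤ y ^ 4 := by positivity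
        linarith

theorem young_step {y ψ κ s S : ℝ} (hy : 0 ≤ y) (hψ : 0 ≤ ψ) (hκ : 0 ≤ κ) (hs : 0 ≤ s)
    (hS : s ≤ S) : s * κ * (y ^ 3 * ψ + y ^ 2) ≤
      y ^ 4 + s ^ 2 * (8 * S ^ 2 * κ ^ 4 * ψ ^ 4 + κ ^ 2 / 2) := by
  have h₁ := young_cubic hy (by positivity : 0 ≤ s * κ * ψ)
  have h₂ : s * κ * y ^ 2 ≤ y ^ 4 / 2 + s ^ 2 * κ ^ 2 / 2 := by
    nlinarith [sq_nonneg (y ^ 2 - s * κ)]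
  have h₃ : 8 * (s * κ * ψ) ^ 4 ≤ s ^ 2 * (8 * S ^ 2 * κ ^ 4 * ψ ^ 4) := by
    calc 8 * (s * κ * ψ) ^ 4 = s ^ 2 * (8 * s ^ 2 * κ ^ 4 * ψ ^ 4) := by ring
      _ ≤ _ := by gcongr
  linarith

/-- The constant bounding the fourth moments of the increments of the chain up to time `T`, given a
bound `M` for the fourth moments of the drift. -/
noncomputable def incrConst (l B M T : ℝ) : ℝ :=
  8 * (T + 1) ^ 2 * (l ^ 2 * stepConst l B 1 0) ^ 4 * (8 * (M + 1)) +
    (l ^ 2 * stepConst l B 1 0) ^ 2 / 2 + l ^ 4 * stepConst l B 1 0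

theorem incrConst_nonneg {l B M T : ℝ} (hB : 0 ≤ B) (hM : 0 ≤ M) : 0 ≤ incrConst l B M T := by
  have := stepConst_nonneg (l := l) hB zero_le_one le_rfl
  unfold incrConst
  positivity

theorem IsInput.increment_bound (h : IsInput P X₀ G U) (hV : PotentialBounds V B) {T : ℕ} {M : ℝ}
    (hint : ∀ k ≤ n * T, Integrable (fun ω => deriv V (chain V l X₀ G U k ω (first n)) ^ 4) P)
    (hM : ∀ k ≤ n * T, ∫ ω, deriv V (chain V l X₀ G U k ω (first n)) ^ 4 ∂P ≤ M)
    (i j : ℕ) (hij : i + j ≤ n * T) :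
    Integrable (fun ω => (chain V l X₀ G U (i + j) ω (first n) -
      chain V l X₀ G U i ω (first n)) ^ 4) P ∧
    ∫ ω, (chain V l X₀ G U (i + j) ω (first n) - chain V l X₀ G U i ω (first n)) ^ 4 ∂P ≤
      incrConst l B M T * ((j : ℝ) / n) ^ 2 := by
  have hM0 : 0 ≤ M := (integral_nonneg fun ω => by positivity).trans (hM 0 (by omega))
  induction j with
  | zero => simp
  | succ j ih =>
    obtain ⟨ihi, ihle⟩ := ih (by omega)
    set k := i + j with hk
    have hφi := hint k (by omega)
    have hφM := hM k (by omega)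
    obtain ⟨χ, hχ, eχ⟩ := exists_chain_eq_past hV.measurable l X₀ G U (le_refl k)
    obtain ⟨χ', hχ', eχ'⟩ := exists_chain_eq_past hV.measurable l X₀ G U (by omega : i ≤ k)
    obtain ⟨s, hs, es⟩ := exists_otherExponent_eq_past hV.measurable l X₀ G U k
    have mk := h.measurable_chain_first (l := l) hV.measurable k
    have mk' := h.measurable_chain_first (l := l) hV.measurable (k + 1)
    have md := hV.measurable_deriv
    have mx : Measurable fun w => χ w (first n) := (measurable_pi_apply _).comp hχ
    have mx' : Measurable fun w => χ' w (first n) := (measurable_pi_apply _).comp hχ'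
    set X : Ω → ℝ := fun ω => chain V l X₀ G U k ω (first n) with hX
    set X' : Ω → ℝ := fun ω => chain V l X₀ G U (k + 1) ω (first n) with hX'
    set Z : Ω → ℝ := fun ω => chain V l X₀ G U i ω (first n) with hZ
    have eX : ∀ ω, χ (past X₀ G U k ω) (first n) = X ω := fun ω => by rw [← eχ]
    have eZ : ∀ ω, χ' (past X₀ G U k ω) (first n) = Z ω := fun ω => by rw [← eχ']
    obtain ⟨hi, hle⟩ := integral_add_pow_four_le (h.measurable_past k) (h.measurable_G 0 k)
      (h.measurable_U k) (h.indepFun_past_G k) (h.indepFun_past_U k) (h.map_G 0 k) (h.map_U k)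
      hV.measurable md hV.nonneg hV.abs_sub_le mx hs (abs_div_sqrt_le l n)
      (F := fun w => χ w (first n) - χ' w (first n)) (c := fun _ => 1)
      (mx.sub mx') measurable_const (b := 1) (γ := 0) le_rfl
      (r := fun ω => X' ω - X ω) (h := fun ω => X' ω - X ω)
      (fun ω => by
        simp only [hX', chain_succ_first, ← es, eX]
        simp only [hX]
        ring)
      (mk'.sub mk) (fun w => by simp) (fun ω => by simp) (fun ω => by simp)
      (by simpa only [eX, eZ] using ihi) (by simpa only [eX] using hφi)
    have eD : ∀ ω, X ω - Z ω + (X' ω - X ω) = X' ω - Z ω := fun ω => by ring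
    simp only [eX, eZ, eD] at hi hle
    refine ⟨hi, ?_⟩
    change _ ≤ _ + _ * stepConst l B 1 0 * _ + _ * stepConst l B 1 0 at hle
    change ∫ ω, (X' ω - Z ω) ^ 4 ∂P ≤ _
    change ∫ ω, (X ω - Z ω) ^ 4 ∂P ≤ _ at ihle
    rw [sq_div_sqrt, pow_four_div_sqrt] at hle
    have hK := stepConst_nonneg (l := l) hV.nonneg zero_le_one le_rfl
    set K := stepConst l B 1 0 with hKdef
    have hn : (0 : ℝ) < n := zero_lt_one.trans_le (one_le_cast n)
    have hj : ((j + 1 : ℕ) : ℝ) = j + 1 := by push_cast; ring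
    have hj0 : (0 : ℝ) ≤ j := by positivity
    set σ : ℝ := (j + 1) / n with hσ
    have hσ0 : 0 < σ := by positivity
    have hσT : σ ≤ T + 1 := by
      rw [hσ, div_le_iff₀ hn]
      have : ((j + 1 : ℕ) : ℝ) ≤ ((n : ℕ) * T : ℕ) := by exact_mod_cast (by omega)
      push_cast at this
      nlinarith
    set I := ∫ ω, (|X ω - Z ω| ^ 3 * (|deriv V (X ω)| + 1) + (X ω - Z ω) ^ 2) ∂P with hI
    set u := ∫ ω, (X ω - Z ω) ^ 4 ∂P with hu
    have hyoung : σ * (l ^ 2 * K) * I ≤ u + σ ^ 2 * (8 * (T + 1) ^ 2 * (l ^ 2 * K) ^ 4 *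
        (8 * (M + 1)) + (l ^ 2 * K) ^ 2 / 2) := by
      have hψi : Integrable (fun ω => 8 * (deriv V (X ω) ^ 4 + 1)) P :=
        (hφi.add (integrable_const 1)).const_mul 8
      have hψ : ∫ ω, 8 * (deriv V (X ω) ^ 4 + 1) ∂P ≤ 8 * (M + 1) := by
        rw [integral_const_mul, integral_add hφi (integrable_const _)]
        simpa using hφM
      have hDi : Integrable (fun ω => (X ω - Z ω) ^ 4) P := ihi
      have hr : Integrable (fun ω => σ ^ 2 * (8 * (T + 1) ^ 2 * (l ^ 2 * K) ^ 4 *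
          (8 * (deriv V (X ω) ^ 4 + 1)) + (l ^ 2 * K) ^ 2 / 2)) P :=
        ((hψi.const_mul _).add (integrable_const _)).const_mul _
      calc σ * (l ^ 2 * K) * I ≤ ∫ ω, ((X ω - Z ω) ^ 4 + σ ^ 2 * (8 * (T + 1) ^ 2 *
            (l ^ 2 * K) ^ 4 * (8 * (deriv V (X ω) ^ 4 + 1)) + (l ^ 2 * K) ^ 2 / 2)) ∂P := by
            rw [hI, ← integral_const_mul]
            refine integral_mono_of_nonneg (ae_of_all _ fun ω => by positivity)
              (hDi.add hr) (ae_of_all _ fun ω => ?_)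
            dsimp only
            have h₁ := young_step (abs_nonneg (X ω - Z ω))
              (by positivity : 0 ≤ |deriv V (X ω)| + 1) (by positivity : 0 ≤ l ^ 2 * K)
              hσ0.le hσT
            have e₁ : |X ω - Z ω| ^ 4 = (X ω - Z ω) ^ 4 := by
              rw [← abs_pow, abs_of_nonneg (by positivity)]
            have e₂ : |deriv V (X ω)| ^ 4 = deriv V (X ω) ^ 4 := by
              rw [← abs_pow, abs_of_nonneg (by positivity)]
            have h₂ : (|deriv V (X ω)| + 1) ^ 4 ≤ 8 * (deriv V (X ω) ^ 4 + 1) := by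
              rw [← e₂]
              have := add_pow_le (abs_nonneg (deriv V (X ω))) zero_le_one 4
              norm_num at this
              exact this
            rw [e₁, sq_abs] at h₁
            refine h₁.trans ?_
            gcongr
        _ ≤ _ := by
            rw [integral_add hDi hr, integral_const_mul,
              integral_add (hψi.const_mul _) (integrable_const _), integral_const_mul]
            simp only [integral_const, probReal_univ, one_smul]
            gcongr
    set C' := 8 * ((T : ℝ) + 1) ^ 2 * (l ^ 2 * K) ^ 4 * (8 * (M + 1)) + (l ^ 2 * K) ^ 2 / 2 with hC'
    have hC'0 : 0 ≤ C' := by positivity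
    have hCdef : incrConst l B M T = C' + l ^ 4 * K := rfl
    have hlK : 0 ≤ l ^ 4 * K := by positivity
    have h₁ : l ^ 2 / (n : ℝ) * K * I ≤ u / (j + 1) + C' * (j + 1) / (n : ℝ) ^ 2 := by
      have e₁ : l ^ 2 / (n : ℝ) * K * I = σ * (l ^ 2 * K) * I / (j + 1) := by
        rw [hσ]
        field_simp
      have e₂ : u / (j + 1) + C' * (j + 1) / (n : ℝ) ^ 2 = (u + σ ^ 2 * C') / (j + 1) := by
        rw [hσ]
        field_simp
      rw [e₁, e₂]
      gcongr
    rw [hCdef] at ihle ⊢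
    have h₂ : u / (j + 1) ≤ (C' + l ^ 4 * K) * ((j : ℝ) / n) ^ 2 / (j + 1) := by gcongr
    have h₃ : l ^ 4 / (n : ℝ) ^ 2 * K ≤ l ^ 4 * K * (j + 1) / (n : ℝ) ^ 2 := by
      rw [div_mul_eq_mul_div]
      exact div_le_div_of_nonneg_right (le_mul_of_one_le_right hlK (by linarith)) (by positivity)
    have h₄ : (j : ℝ) ^ 2 + j ^ 2 / (j + 1) + (j + 1) ≤ (j + 1) ^ 2 := by
      have : (j : ℝ) ^ 2 / (j + 1) ≤ j := by
        rw [div_le_iff₀ (by positivity), sq]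
        exact mul_le_mul_of_nonneg_left (by linarith) hj0
      linarith [add_sq (j : ℝ) 1]
    have h₅ := mul_le_mul_of_nonneg_left h₄
      (by positivity : 0 ≤ (C' + l ^ 4 * K) / (n : ℝ) ^ 2)
    have e : (C' + l ^ 4 * K) / (n : ℝ) ^ 2 * ((j : ℝ) ^ 2 + j ^ 2 / (j + 1) + (j + 1)) =
        (C' + l ^ 4 * K) * ((j : ℝ) / n) ^ 2 + (C' + l ^ 4 * K) * ((j : ℝ) / n) ^ 2 / (j + 1) +
        C' * (j + 1) / (n : ℝ) ^ 2 + l ^ 4 * K * (j + 1) / (n : ℝ) ^ 2 := by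
      field_simp
      ring
    have e' : (C' + l ^ 4 * K) * (((j + 1 : ℕ) : ℝ) / n) ^ 2 =
        (C' + l ^ 4 * K) / (n : ℝ) ^ 2 * ((j : ℝ) + 1) ^ 2 := by
      rw [hj]
      field_simp
    rw [e']
    linarith

end Moments

section Interpolation

theorem continuous_uncurry_interp (n : ℕ+) :
    Continuous fun p : (ℕ → ℝ) × ℝ≥0 => interp n p.1 p.2 := by
  let S : ℕ → Set ((ℕ → ℝ) × ℝ≥0) := fun k => {p | (k : ℝ) ≤ (n : ℝ) * p.2 ∧ (n : ℝ) * p.2 ≤ k + 1}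
  have hS : LocallyFinite S := by
    intro p
    refine ⟨{q | (n : ℝ) * q.2 < (n : ℝ) * p.2 + 1}, ?_, ?_⟩
    · exact (isOpen_lt (by fun_prop) continuous_const).mem_nhds (by simp)
    · refine (Set.finite_le_nat ⌈(n : ℝ) * p.2 + 1⌉₊).subset ?_
      rintro k ⟨q, hq₁, hq₂⟩
      have h : (k : ℝ) ≤ (n : ℝ) * p.2 + 1 := le_trans hq₁.1 (le_of_lt hq₂)
      exact_mod_cast h.trans (Nat.le_ceil _)
  refine hS.continuous ?_ (fun k => ?_) (fun k => ?_)
  · exact Set.eq_univ_of_forall fun p => Set.mem_iUnion.2 ⟨⌊(n : ℝ) * p.2⌋₊,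
      Nat.floor_le (by positivity), (Nat.lt_floor_add_one _).le⟩
  · exact (isClosed_le (f := fun _ => (k : ℝ)) (g := fun p : (ℕ → ℝ) × ℝ≥0 => (n : ℝ) * p.2)
      (by fun_prop) (by fun_prop)).inter (isClosed_le (f := fun p : (ℕ → ℝ) × ℝ≥0 => (n : ℝ) * p.2)
      (g := fun _ => (k : ℝ) + 1) (by fun_prop) (by fun_prop))
  · exact ContinuousOn.congr (f := fun p : (ℕ → ℝ) × ℝ≥0 => p.1 k +
      ((n : ℝ) * p.2 - k) * (p.1 (k + 1) - p.1 k)) (by fun_prop)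
      (fun p hp => interp_eq n p.1 k p.2 hp.1 hp.2)

theorem measurable_interpPath (n : ℕ+) : Measurable (interpPath n) :=
  (ContinuousMap.continuous_of_continuous_uncurry _ (continuous_uncurry_interp n)).measurable

theorem interp_floor (n : ℕ+) (x : ℕ → ℝ) (t : ℝ≥0) :
    interp n x t = x ⌊(n : ℝ) * t⌋₊ + ((n : ℝ) * t - ⌊(n : ℝ) * t⌋₊) *
      (x (⌊(n : ℝ) * t⌋₊ + 1) - x ⌊(n : ℝ) * t⌋₊) :=
  interp_eq n x _ t (Nat.floor_le (by positivity)) (Nat.lt_floor_add_one _).le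

variable {Ω : Type*} [MeasurableSpace Ω] {P : Measure Ω} {n : ℕ+} {x : Ω → ℕ → ℝ}

theorem lintegral_ofReal_le_of_le {f g : Ω → ℝ} {c : ℝ} (hfg : ∀ ω, f ω ≤ g ω)
    (hg0 : ∀ ω, 0 ≤ g ω) (hg : Integrable g P) (hc : ∫ ω, g ω ∂P ≤ c) :
    ∫⁻ ω, ENNReal.ofReal (f ω) ∂P ≤ ENNReal.ofReal c := by
  refine (lintegral_mono fun ω => ENNReal.ofReal_le_ofReal (hfg ω)).trans ?_
  rw [← ofReal_integral_eq_lintegral_ofReal hg (ae_of_all _ hg0)]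
  exact ENNReal.ofReal_le_ofReal hc

theorem add_add_pow_four_le (p q r : ℝ) : (p + q + r) ^ 4 ≤ 27 * (p ^ 4 + q ^ 4 + r ^ 4) := by
  have h₁ : (p + q + r) ^ 2 ≤ 3 * (p ^ 2 + q ^ 2 + r ^ 2) := by
    nlinarith [sq_nonneg (p - q), sq_nonneg (q - r), sq_nonneg (p - r)]
  have h₂ : (p ^ 2 + q ^ 2 + r ^ 2) ^ 2 ≤ 3 * (p ^ 4 + q ^ 4 + r ^ 4) := by
    nlinarith [sq_nonneg (p ^ 2 - q ^ 2), sq_nonneg (q ^ 2 - r ^ 2), sq_nonneg (p ^ 2 - r ^ 2)]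
  calc (p + q + r) ^ 4 = ((p + q + r) ^ 2) ^ 2 := by ring
    _ ≤ (3 * (p ^ 2 + q ^ 2 + r ^ 2)) ^ 2 := by gcongr
    _ = 9 * (p ^ 2 + q ^ 2 + r ^ 2) ^ 2 := by ring
    _ ≤ _ := by linarith

theorem floor_mul_lt (n : ℕ+) {t : ℝ≥0} {N : ℕ} (ht : t ≤ N) :
    ⌊(n : ℝ) * t⌋₊ + 1 ≤ n * (N + 1) := by
  have h : ⌊(n : ℝ) * t⌋₊ ≤ n * N := by
    refine Nat.floor_le_of_le ?_
    push_cast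
    gcongr
    exact_mod_cast ht
  have := n.pos
  nlinarith

/-- Bounds on the increments of a random sequence give bounds on those of its interpolation. -/
theorem lintegral_interp_increment_le {N : ℕ} {C : ℝ} (hC : 0 ≤ C)
    (hx : ∀ i j : ℕ, i + j ≤ n * (N + 1) → Integrable (fun ω => (x ω (i + j) - x ω i) ^ 4) P ∧
      ∫ ω, (x ω (i + j) - x ω i) ^ 4 ∂P ≤ C * ((j : ℝ) / n) ^ 2)
    {s t : ℝ≥0} (hst : s ≤ t) (ht : t ≤ N) :
    ∫⁻ ω, ENNReal.ofReal ((interp n (x ω) t - interp n (x ω) s) ^ 4) ∂P ≤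
      ENNReal.ofReal (27 * C * ((t : ℝ) - s) ^ 2) := by
  have hn : (0 : ℝ) < n := by exact_mod_cast n.pos
  have hst' : (n : ℝ) * s ≤ n * t := by gcongr
  simp only [interp_floor]
  have hb := floor_mul_lt n ht
  have hab : ⌊(n : ℝ) * s⌋₊ ≤ ⌊(n : ℝ) * t⌋₊ := Nat.floor_mono hst'
  have θ₀ := Nat.floor_le (by positivity : 0 ≤ (n : ℝ) * s)
  have θ₁ := (Nat.lt_floor_add_one ((n : ℝ) * s)).le
  have η₀ := Nat.floor_le (by positivity : 0 ≤ (n : ℝ) * t)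
  have η₁ := (Nat.lt_floor_add_one ((n : ℝ) * t)).le
  set a := ⌊(n : ℝ) * s⌋₊
  set b := ⌊(n : ℝ) * t⌋₊
  obtain ⟨ia, la⟩ := hx a 1 (by omega)
  obtain ⟨ib, lb⟩ := hx b 1 hb
  have ets : (t : ℝ) - s = ((n : ℝ) * t - n * s) / n := by field_simp
  have hpow : ∀ z : ℝ, 0 ≤ z → z ≤ 1 → z ^ 4 ≤ z ^ 2 := fun z h₀ h₁ =>
    pow_le_pow_of_le_one h₀ h₁ (by norm_num)
  rcases hab.eq_or_lt with h | h
  · rw [← h] at η₁ η₀ ⊢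
    set z := (n : ℝ) * t - n * s with hz
    have hz4 := hpow z (by linarith) (by linarith)
    refine lintegral_ofReal_le_of_le (g := fun ω => z ^ 4 * (x ω (a + 1) - x ω a) ^ 4)
      (fun ω => le_of_eq (by rw [hz]; ring)) (fun ω => by positivity) (ia.const_mul _) ?_
    rw [integral_const_mul, ets]
    calc z ^ 4 * ∫ ω, (x ω (a + 1) - x ω a) ^ 4 ∂P ≤ z ^ 2 * (C * (((1 : ℕ) : ℝ) / n) ^ 2) := by
          gcongr
      _ = C * (z / n) ^ 2 := by
          push_cast
          ring
      _ ≤ 27 * C * (z / n) ^ 2 := by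
          gcongr
          linarith
  · obtain ⟨j, hj⟩ := Nat.exists_eq_add_of_lt h
    obtain ⟨ij, lj⟩ := hx (a + 1) j (by omega)
    have eb : a + 1 + j = b := by omega
    rw [eb] at ij lj
    set η := (n : ℝ) * t - b with hη
    set θ := (n : ℝ) * s - a with hθ
    have ebR : (b : ℝ) = a + 1 + j := by rw [← eb]; push_cast; ring
    have iη : Integrable (fun ω => η ^ 4 * (x ω (b + 1) - x ω b) ^ 4) P := ib.const_mul _
    have iθ : Integrable (fun ω => (1 - θ) ^ 4 * (x ω (a + 1) - x ω a) ^ 4) P := ia.const_mul _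
    have iηj : Integrable (fun ω => η ^ 4 * (x ω (b + 1) - x ω b) ^ 4 +
        (x ω b - x ω (a + 1)) ^ 4) P := iη.add ij
    have hint : Integrable (fun ω => 27 * (η ^ 4 * (x ω (b + 1) - x ω b) ^ 4 +
        (x ω b - x ω (a + 1)) ^ 4 + (1 - θ) ^ 4 * (x ω (a + 1) - x ω a) ^ 4)) P :=
      (iηj.add iθ).const_mul _
    refine lintegral_ofReal_le_of_le (fun ω => ?_) (fun ω => by positivity) hint ?_
    · have := add_add_pow_four_le (η * (x ω (b + 1) - x ω b)) (x ω b - x ω (a + 1))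
        ((1 - θ) * (x ω (a + 1) - x ω a))
      rw [mul_pow, mul_pow] at this
      refine le_trans (le_of_eq ?_) this
      ring
    · rw [integral_const_mul, integral_add iηj iθ, integral_add iη ij,
        integral_const_mul, integral_const_mul]
      have hη4 := hpow η (by linarith) (by linarith)
      have hθ4 := hpow (1 - θ) (by linarith) (by linarith)
      have l₁ : η ^ 4 * ∫ ω, (x ω (b + 1) - x ω b) ^ 4 ∂P ≤ η ^ 2 * (C * (((1 : ℕ) : ℝ) / n) ^ 2) := by
        gcongr
      have l₂ : (1 - θ) ^ 4 * ∫ ω, (x ω (a + 1) - x ω a) ^ 4 ∂P ≤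
          (1 - θ) ^ 2 * (C * (((1 : ℕ) : ℝ) / n) ^ 2) := by
        gcongr
      have e : (t : ℝ) - s = (η + j + (1 - θ)) / n := by
        rw [ets, hη, hθ, ebR]
        ring
      have hsq : η ^ 2 + (j : ℝ) ^ 2 + (1 - θ) ^ 2 ≤ (η + j + (1 - θ)) ^ 2 := by
        have h₁ : 0 ≤ η := by linarith
        have h₂ : 0 ≤ 1 - θ := by linarith
        have h₃ : (0 : ℝ) ≤ j := by positivity
        nlinarith [mul_nonneg h₁ h₂, mul_nonneg h₁ h₃, mul_nonneg h₂ h₃]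
      calc _ ≤ 27 * (η ^ 2 * (C * (((1 : ℕ) : ℝ) / n) ^ 2) + C * ((j : ℝ) / n) ^ 2 +
            (1 - θ) ^ 2 * (C * (((1 : ℕ) : ℝ) / n) ^ 2)) := by gcongr
        _ = 27 * (C / (n : ℝ) ^ 2) * (η ^ 2 + (j : ℝ) ^ 2 + (1 - θ) ^ 2) := by
            push_cast
            field_simp
        _ ≤ 27 * (C / (n : ℝ) ^ 2) * (η + j + (1 - θ)) ^ 2 := by gcongr
        _ = _ := by
            rw [e]
            field_simp

theorem lintegral_deriv_interp_le {V : ℝ → ℝ} {B : ℝ} (hV : PotentialBounds V B) {N : ℕ} {C M : ℝ}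
    (hC : 0 ≤ C)
    (hx : ∀ i j : ℕ, i + j ≤ n * (N + 1) → Integrable (fun ω => (x ω (i + j) - x ω i) ^ 4) P ∧
      ∫ ω, (x ω (i + j) - x ω i) ^ 4 ∂P ≤ C * ((j : ℝ) / n) ^ 2)
    (hi : ∀ k ≤ n * (N + 1), Integrable (fun ω => deriv V (x ω k) ^ 4) P)
    (hM : ∀ k ≤ n * (N + 1), ∫ ω, deriv V (x ω k) ^ 4 ∂P ≤ M)
    {t : ℝ≥0} (ht : t ≤ N) :
    ∫⁻ ω, ENNReal.ofReal (deriv V (interp n (x ω) t) ^ 4) ∂P ≤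
      ENNReal.ofReal (8 * (M + B ^ 4 * C)) := by
  have hb := floor_mul_lt n ht
  have hn : (1 : ℝ) ≤ n := by exact_mod_cast n.pos
  simp only [interp_floor]
  have η₀ := Nat.floor_le (by positivity : 0 ≤ (n : ℝ) * t)
  have η₁ := (Nat.lt_floor_add_one ((n : ℝ) * t)).le
  set b := ⌊(n : ℝ) * t⌋₊
  set η := (n : ℝ) * t - b with hη
  obtain ⟨ib, lb⟩ := hx b 1 hb
  have hB := hV.nonneg
  have iφ := hi b (by omega)
  have iδ : Integrable (fun ω => B ^ 4 * (x ω (b + 1) - x ω b) ^ 4) P := ib.const_mul _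
  have isum : Integrable (fun ω => 8 * (deriv V (x ω b) ^ 4 +
      B ^ 4 * (x ω (b + 1) - x ω b) ^ 4)) P := (iφ.add iδ).const_mul 8
  refine lintegral_ofReal_le_of_le (fun ω => ?_) (fun ω => by positivity) isum ?_
  · have h₁ := hV.abs_deriv_sub_le (x ω b) (η * (x ω (b + 1) - x ω b))
    have h₂ : |η * (x ω (b + 1) - x ω b)| ≤ |x ω (b + 1) - x ω b| := by
      rw [abs_mul]
      refine mul_le_of_le_one_left (abs_nonneg _) ?_
      rw [abs_le]
      constructor <;> linarith
    have h₃ : |deriv V (x ω b + η * (x ω (b + 1) - x ω b))| ≤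
        |deriv V (x ω b)| + B * |x ω (b + 1) - x ω b| := by
      have h₄ := abs_sub_abs_le_abs_sub (deriv V (x ω b + η * (x ω (b + 1) - x ω b)))
        (deriv V (x ω b))
      have h₅ := mul_le_mul_of_nonneg_left h₂ hB
      linarith
    have h₄ := add_pow_le (abs_nonneg (deriv V (x ω b)))
      (by positivity : 0 ≤ B * |x ω (b + 1) - x ω b|) 4
    norm_num at h₄
    rw [mul_pow, Even.pow_abs (by decide), Even.pow_abs (by decide)] at h₄
    rw [← Even.pow_abs (n := 4) (by decide) (deriv V (x ω b + η * (x ω (b + 1) - x ω b)))]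
    exact (by gcongr : _ ≤ (|deriv V (x ω b)| + B * |x ω (b + 1) - x ω b|) ^ 4).trans h₄
  · rw [integral_const_mul, integral_add iφ iδ, integral_const_mul]
    have l : ∫ ω, (x ω (b + 1) - x ω b) ^ 4 ∂P ≤ C := by
      refine lb.trans (mul_le_of_le_one_right hC ?_)
      refine pow_le_one₀ (by positivity) ?_
      rw [div_le_one (by linarith)]
      exact_mod_cast hn
    have := hM b (by omega)
    gcongr

end Interpolation

end RWM

open RWM in
theorem proposition4
    {Ω : Type*} [MeasurableSpace Ω] (P : Measure Ω) [IsProbabilityMeasure P]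
    (l : ℝ) (V : ℝ → ℝ)
    (hV : ContDiff ℝ 3 V)
    (hV2 : ∃ B : ℝ, ∀ x, |iteratedDeriv 2 V x| ≤ B)
    (hV3 : ∃ B : ℝ, ∀ x, |iteratedDeriv 3 V x| ≤ B)
    (G : ℕ → ℕ → Ω → ℝ) (U : ℕ → Ω → ℝ) (X₀ : (n : ℕ+) → Ω → Fin n → ℝ)
    (hGm : ∀ i k, Measurable (G i k)) (hUm : ∀ k, Measurable (U k))
    (hXm : ∀ n, Measurable (X₀ n))
    (hGlaw : ∀ i k, HasLaw (G i k) (gaussianReal 0 1) P)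
    (hGindep : iIndepFun (fun (p : ℕ × ℕ) ω => G p.1 p.2 ω) P)
    (hUlaw : ∀ k, HasLaw (U k) (volume.restrict (Set.Icc (0 : ℝ) 1)) P)
    (hUindep : iIndepFun U P)
    (hGU : IndepFun (fun ω (p : ℕ × ℕ) => G p.1 p.2 ω) (fun ω k => U k ω) P)
    (hX : ∀ n, IndepFun (X₀ n)
      (fun ω => ((fun p : ℕ × ℕ => G p.1 p.2 ω), (fun k : ℕ => U k ω))) P)
    (hexch : ∀ n, RWM.Exchangeable P (X₀ n))
    (htight : IsTightMeasureSet
      (Set.range fun n : ℕ+ => P.map (fun ω => X₀ n ω (RWM.first n))))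
    (hmom : (⨆ n : ℕ+, ∫⁻ ω, ENNReal.ofReal (deriv V (X₀ n ω (RWM.first n)) ^ 4) ∂P) < ∞) :
    (∀ n : ℕ+, Measurable (RWM.Y V l n (X₀ n) G U)) ∧
    IsTightMeasureSet (Set.range fun n : ℕ+ => P.map (RWM.Y V l n (X₀ n) G U)) ∧
    ∀ t₀ : ℝ≥0, ∃ C : ℝ≥0, ∀ᶠ t in 𝓝 t₀,
      (⨆ n : ℕ+, ∫⁻ ω, ENNReal.ofReal (deriv V (RWM.Y V l n (X₀ n) G U ω t) ^ 4) ∂P) ≤ (C : ℝ≥0∞) := by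
  obtain ⟨B, hVB⟩ := exists_potentialBounds hV hV2 hV3
  have hin : ∀ n, IsInput P (X₀ n) G U := fun n => ⟨hGm, hUm, hXm n, fun i k => (hGlaw i k).map_eq,
    fun k => (hUlaw k).map_eq, hGindep, hUindep, hGU, hX n⟩
  have hYm : ∀ n : ℕ+, Measurable (RWM.Y V l n (X₀ n) G U) := fun n =>
    (measurable_interpPath n).comp (measurable_pi_lambda _ fun k =>
      (hin n).measurable_chain_first hVB.measurable k)
  set S := ⨆ n : ℕ+, ∫⁻ ω, ENNReal.ofReal (deriv V (X₀ n ω (RWM.first n)) ^ 4) ∂P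
  have hm0 : ∀ n : ℕ+, Measurable fun ω => deriv V (X₀ n ω (first n)) ^ 4 := fun n =>
    (hVB.measurable_deriv.comp ((measurable_pi_apply _).comp (hXm n))).pow_const 4
  have hS : ∀ n : ℕ+, ∫⁻ ω, ENNReal.ofReal (deriv V (X₀ n ω (first n)) ^ 4) ∂P ≤ S := fun n =>
    le_iSup (fun n : ℕ+ => ∫⁻ ω, ENNReal.ofReal (deriv V (X₀ n ω (first n)) ^ 4) ∂P) n
  have hint0 : ∀ n : ℕ+, Integrable (fun ω => deriv V (X₀ n ω (first n)) ^ 4) P := fun n =>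
    ⟨(hm0 n).aestronglyMeasurable, by
      rw [hasFiniteIntegral_iff_ofReal (ae_of_all _ fun ω => by positivity)]
      exact (hS n).trans_lt hmom⟩
  have hle0 : ∀ n : ℕ+, ∫ ω, deriv V (X₀ n ω (first n)) ^ 4 ∂P ≤ S.toReal := fun n => by
    rw [integral_eq_lintegral_of_nonneg_ae (ae_of_all _ fun ω => by positivity)
      (hm0 n).aestronglyMeasurable]
    exact ENNReal.toReal_mono hmom.ne (hS n)
  have hK := stepConst_nonneg (l := l) hVB.nonneg hVB.nonneg hVB.nonneg
  set M : ℕ → ℝ := fun T => (S.toReal + 1) *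
    Real.exp (stepConst l B B B * (3 * l ^ 2 + l ^ 4) * T) with hMdef
  have hM0 : ∀ T, 0 ≤ M T := fun T => by positivity
  have hφi : ∀ (n : ℕ+) (k : ℕ), Integrable
      (fun ω => deriv V (chain V l (X₀ n) G U k ω (first n)) ^ 4) P := fun n k =>
    ((hin n).moment_bound hVB (hint0 n) k).1
  have hφM : ∀ (n : ℕ+) (T k : ℕ), k ≤ n * T →
      ∫ ω, deriv V (chain V l (X₀ n) G U k ω (first n)) ^ 4 ∂P ≤ M T := by
    intro n T k hk
    have h := ((hin n).moment_bound hVB (hint0 n) k (l := l)).2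
    have hn : (0 : ℝ) < n := by exact_mod_cast n.pos
    have hkT : (k : ℝ) / n ≤ T := by
      rw [div_le_iff₀ hn, mul_comm]
      exact_mod_cast hk
    have h₂ : (∫ ω, deriv V (X₀ n ω (first n)) ^ 4 ∂P + 1) *
        Real.exp (stepConst l B B B * (3 * l ^ 2 + l ^ 4) * (k / n)) ≤ M T := by
      have := hle0 n
      simp only [hMdef]
      gcongr
    linarith
  have hinc : ∀ (n : ℕ+) (N i j : ℕ), i + j ≤ n * (N + 1) →
      Integrable (fun ω => (chain V l (X₀ n) G U (i + j) ω (first n) -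
        chain V l (X₀ n) G U i ω (first n)) ^ 4) P ∧
      ∫ ω, (chain V l (X₀ n) G U (i + j) ω (first n) -
        chain V l (X₀ n) G U i ω (first n)) ^ 4 ∂P ≤
        incrConst l B (M (N + 1)) (N + 1 : ℕ) * ((j : ℝ) / n) ^ 2 := fun n N i j hij =>
    (hin n).increment_bound hVB (fun k _ => hφi n k) (fun k hk => hφM n (N + 1) k hk) i j hij
  have hC0 : ∀ N : ℕ, 0 ≤ incrConst l B (M (N + 1)) (N + 1 : ℕ) := fun N =>
    incrConst_nonneg hVB.nonneg (hM0 _)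
  have eY : ∀ (n : ℕ+) (ω : Ω) (t : ℝ≥0), RWM.Y V l n (X₀ n) G U ω t =
      interp n (fun k => chain V l (X₀ n) G U k ω (first n)) t := fun _ _ _ => rfl
  refine ⟨hYm, isTightMeasureSet_of_increments hYm ?_ fun N => ?_, fun t₀ => ?_⟩
  · have e : ∀ (n : ℕ+) (ω : Ω), RWM.Y V l n (X₀ n) G U ω 0 = X₀ n ω (first n) := fun n ω => by
      simp [RWM.Y, interpPath, interp, chain]
    simpa only [e] using htight
  · refine ⟨27 * incrConst l B (M (N + 1)) (N + 1 : ℕ), mul_nonneg (by norm_num) (hC0 N),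
      fun n s t hst ht => ?_⟩
    simp only [eY]
    exact lintegral_interp_increment_le (x := fun ω k => chain V l (X₀ n) G U k ω (first n))
      (hC0 N) (hinc n N) hst ht
  · obtain ⟨N, hN⟩ := exists_nat_gt t₀
    refine ⟨(8 * (M (N + 1) + B ^ 4 * incrConst l B (M (N + 1)) (N + 1 : ℕ))).toNNReal, ?_⟩
    filter_upwards [eventually_lt_nhds hN] with t ht
    refine iSup_le fun n => ?_
    simp only [eY]
    exact lintegral_deriv_interp_le (x := fun ω k => chain V l (X₀ n) G U k ω (first n)) hVB
      (hC0 N) (hinc n N) (fun k _ => hφi n k) (fun k hk => hφM n (N + 1) k hk) ht.le
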